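/- Let $n\ge 1$ be an integer, $R>0$, $A>0$, $p>1$, $0\le k<2/(p-1)$ and $\varepsilon_0>0$. Then there is a constant $C>0$, depending only on $n,R,A,p,k,\varepsilon_0$, with the following property. Let $F\colon\mathbb R\to\mathbb R$ be a $\mathcal C^1$ function with $F(0)=0$ and $$F'(u)\ge 0,\qquad F(u)\ge A u^p\qquad\text{for all } u\ge 0,$$ let $V\colon (R,\infty)\to\mathbb R$ be $\mathcal C^1$ and non-positive, let $0<\varepsilon\le\varepsilon_0$, and let $\psi\colon(R,\infty)\to\mathbb R$ be continuous with $\psi(r)\ge\varepsilon r^{-k-1}$ for all $r>R$. For $T>0$ put $\Theta_T=\{(r,t): r>t+R,\ 0\le t<T\}$ and consider the problem $$\partial_t^2u-\partial_r^2u-\frac{n-1}{r}\,\partial_r u=F(u)-V(r)\,u\quad\text{in }\Theta_T,\qquad u(r,0)=0,\quad \partial_tu(r,0)=\psi(r)\quad\text{for } r>R.$$ A solution in $\Theta_T$ is a function $u$ which is continuous and locally bounded in $\Theta_T$, has weak derivatives with $r^{(n-1)/2}(|u|+|\partial_ru|+|\partial_tu|)\in L^2_{\mathrm{loc}}(\Theta_T)$,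 vanishes at $t=0$, and satisfies the equation and the initial condition on $\partial_tu$ in the sense of distributions, that is, $$\iint_{\Theta_T}u\Big(\partial_t^2\varphi-\partial_r^2\varphi+\partial_r\Big(\frac{n-1}{r}\varphi\Big)\Big)\,dr\,dt=\iint_{\Theta_T}\big(F(u)-V(r)u\big)\varphi\,dr\,dt+\int_R^\infty\psi(r)\varphi(r,0)\,dr$$ for every smooth $\varphi$ with compact support in $\{(r,t): r>t+R,\ t<T\}$. Let the lifespan $T_{\max}\in[0,\infty]$ be the supremum of all $T>0$ for which a solution in $\Theta_T$ exists ($T_{\max}=0$ if there is none). Then $$T_{\max}\le C\,\varepsilon^{-(p-1)/(2-k(p-1))}.$$ -/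

import Mathlib

open MeasureTheory Set
open scoped ContDiff ENNReal

noncomputable section

namespace ExteriorWave

/-- The exterior region `Θ_T = {(r, t) : r > t + R, 0 ≤ t < T}`; points are written `(r, t)`. -/
def region (R T : ℝ) : Set (ℝ × ℝ) := {q | q.2 + R < q.1 ∧ 0 ≤ q.2 ∧ q.2 < T}

/-- Smooth real functions on the plane with compact support inside `S`. -/
def IsTest (S : Set (ℝ × ℝ)) (φ : ℝ × ℝ → ℝ) : Prop :=
  ContDiff ℝ ∞ φ ∧ HasCompactSupport φ ∧ tsupport φ ⊆ S

/-- Partial derivative in the first variable `r`. -/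
def dr (φ : ℝ × ℝ → ℝ) (q : ℝ × ℝ) : ℝ := deriv (fun s => φ (s, q.2)) q.1

/-- Partial derivative in the second variable `t`. -/
def dt (φ : ℝ × ℝ → ℝ) (q : ℝ × ℝ) : ℝ := deriv (fun s => φ (q.1, s)) q.2

/-- Membership in `L²_loc` of the region (compact subsets of the region may touch `t = 0`). -/
def L2Loc (R T : ℝ) (f : ℝ × ℝ → ℝ) : Prop :=
  ∀ K : Set (ℝ × ℝ), IsCompact K → K ⊆ region R T → MemLp f 2 (volume.restrict K)

/-- `ur` and `ut` are the weak derivatives of `u` in `r` and in `t` on the interior of the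
region, tested against smooth functions compactly supported there. -/
def HasWeakGradient (R T : ℝ) (u ur ut : ℝ × ℝ → ℝ) : Prop :=
  ∀ φ : ℝ × ℝ → ℝ, IsTest (interior (region R T)) φ →
    (∫ q in region R T, u q * dr φ q) = - ∫ q in region R T, ur q * φ q ∧
    (∫ q in region R T, u q * dt φ q) = - ∫ q in region R T, ut q * φ q

/-- The formal adjoint `φ_tt - φ_rr + ∂_r ((n-1) φ / r)` of the radial wave operator
`∂_t² - ∂_r² - ((n-1)/r) ∂_r`. -/
def adjointOp (n : ℕ) (φ : ℝ × ℝ → ℝ) (q : ℝ × ℝ) : ℝ :=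
  dt (dt φ) q - dr (dr φ) q + dr (fun z => ((n : ℝ) - 1) / z.1 * φ z) q

/-- `u` is a solution in `Θ_T` of
`u_tt - u_rr - ((n-1)/r) u_r = g(r, u)`, `u(r, 0) = 0`, `u_t(r, 0) = ψ(r)` for `r > R`,
which is continuous, locally bounded and of locally finite energy. The equation and the initial
velocity are understood in the sense of distributions: test functions live on the set
`{r > t + R, t < T}`, so that they need not vanish on the initial line `t = 0`. -/
structure IsSolution (n : ℕ) (R T : ℝ) (g : ℝ → ℝ → ℝ) (ψ : ℝ → ℝ) (u : ℝ × ℝ → ℝ) : Prop where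
  continuousOn : ContinuousOn u (region R T)
  locallyBounded : ∀ K : Set (ℝ × ℝ), IsCompact K → K ⊆ region R T → ∃ M : ℝ, ∀ q ∈ K, |u q| ≤ M
  finiteEnergy : ∃ ur ut : ℝ × ℝ → ℝ, HasWeakGradient R T u ur ut ∧
    L2Loc R T (fun q => q.1 ^ (((n : ℝ) - 1) / 2) * u q) ∧
    L2Loc R T (fun q => q.1 ^ (((n : ℝ) - 1) / 2) * ur q) ∧
    L2Loc R T (fun q => q.1 ^ (((n : ℝ) - 1) / 2) * ut q)
  initialPosition : ∀ r : ℝ, R < r → u (r, 0) = 0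
  equation : ∀ φ : ℝ × ℝ → ℝ, IsTest {q | q.2 + R < q.1 ∧ q.2 < T} φ →
    (∫ q in region R T, u q * adjointOp n φ q) =
      (∫ q in region R T, g q.1 (u q) * φ q) + ∫ r in Ioi R, ψ r * φ (r, 0)

/-- The lifespan: the supremum in `[0, ∞]` of all `T > 0` such that a solution exists in `Θ_T`. -/
def lifespan (n : ℕ) (R : ℝ) (g : ℝ → ℝ → ℝ) (ψ : ℝ → ℝ) : ℝ≥0∞ :=
  ⨆ (T : ℝ) (_ : 0 < T) (_ : ∃ u : ℝ × ℝ → ℝ, IsSolution n R T g ψ u), ENNReal.ofReal T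

end ExteriorWave

end

/-!
Put `m = (n - 1) / 2` and `v = r ^ m * u`. Conjugation by `r ^ m` turns the radial wave operator into
the one-dimensional one with potential `m (m - 1) / r²`, and the weak equation becomes an identity
for `v` against arbitrary smooth `χ` supported in a truncated wedge (`IsSolution.reduced_identity`).
The proof uses this identity twice.

*Positivity.* The potential is positive for `n ≥ 4`, and the fundamental solution of the radial wave
equation changes sign in high dimensions, so `u ≥ 0` cannot be expected in all of `Θ_T`. It does hold
in the cone `n t ≤ r - t`, which is closed under passing to backward characteristic triangles: there
`□χ + (m (m - 1) / r²) χ = δ - (bounded nonnegative function)` has the approximate solution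
`χ = 1 - β x y ≥ 0`, with `x`, `y` the characteristic coordinates measured from the vertex
(`exists_triangle_test`). Since the nonlinearity is at least `-Λ u⁻` on bounded sets, this gives
`v ≥ -M ∫ v⁻` over the triangle, and a Gronwall argument, in the form of a weighted minimum, yields
`u ≥ 0` (`IsSolution.nonneg`).

*Blow-up.* Test with `χ (r / T, t / T)` supported where `r ≈ (n + 3) T` and `t ≤ T / 2`, inside that
cone, and not vanishing at `t = 0`. There `A u ^ p` is dominated by the right-hand side, and if `χ` is
a high power of a cutoff, Young's inequality absorbs `u □χ` into it up to
`C T ^ (-2 p / (p - 1))` (`IsSolution.data_le`). Only the data term is left, so that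
`ε T ^ (-k) ≤ C T ^ (2 - 2 p / (p - 1)) = C T ^ (-2 / (p - 1))`, which is the bound for `T`. Times
`T < R`, for which the test function would leave the region, are covered by `ε ≤ ε₀`.
-/

namespace ExteriorWave

open Filter Topology

/-! ### Conjugation to the one-dimensional wave operator -/

/-- The exponent `(n - 1) / 2` of the weight that turns the radial wave operator into the
one-dimensional wave operator with an inverse square potential. -/
noncomputable def halfDim (n : ℕ) : ℝ := ((n : ℝ) - 1) / 2

/-- The one-dimensional wave operator with potential `m (m - 1) / r²`, where `m = (n - 1) / 2`:
the conjugate of `adjointOp n` by `r ^ m`. -/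
noncomputable def reducedOp (n : ℕ) (χ : ℝ × ℝ → ℝ) (q : ℝ × ℝ) : ℝ :=
  dt (dt χ) q - dr (dr χ) q + halfDim n * (halfDim n - 1) / q.1 ^ 2 * χ q

theorem dr_congr {φ φ' : ℝ × ℝ → ℝ} {q : ℝ × ℝ} (h : φ =ᶠ[𝓝 q] φ') :
    dr φ =ᶠ[𝓝 q] dr φ' := by
  filter_upwards [h.eventually_nhds] with z hz
  have hc : Tendsto (fun s : ℝ => (s, z.2)) (𝓝 z.1) (𝓝 z) := by
    have : Continuous (fun s : ℝ => (s, z.2)) := by fun_prop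
    exact this.tendsto z.1
  exact EventuallyEq.deriv_eq (hc.eventually hz)

theorem dt_congr {φ φ' : ℝ × ℝ → ℝ} {q : ℝ × ℝ} (h : φ =ᶠ[𝓝 q] φ') :
    dt φ =ᶠ[𝓝 q] dt φ' := by
  filter_upwards [h.eventually_nhds] with z hz
  have hc : Tendsto (fun s : ℝ => (z.1, s)) (𝓝 z.2) (𝓝 z) := by
    have : Continuous (fun s : ℝ => (z.1, s)) := by fun_prop
    exact this.tendsto z.2
  exact EventuallyEq.deriv_eq (hc.eventually hz)

theorem adjointOp_congr (n : ℕ) {φ φ' : ℝ × ℝ → ℝ} {q : ℝ × ℝ} (h : φ =ᶠ[𝓝 q] φ') :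
    adjointOp n φ q = adjointOp n φ' q := by
  unfold adjointOp
  rw [(dt_congr (dt_congr h)).eq_of_nhds, (dr_congr (dr_congr h)).eq_of_nhds]
  congr 1
  refine (dr_congr ?_).eq_of_nhds
  filter_upwards [h] with z hz
  rw [hz]

theorem hasDerivAt_dr {χ : ℝ × ℝ → ℝ} (hχ : ContDiff ℝ ∞ χ) (r t : ℝ) :
    HasDerivAt (fun s => χ (s, t)) (dr χ (r, t)) r := by
  have h : ContDiff ℝ ∞ (fun s : ℝ => χ (s, t)) := by fun_prop
  exact (h.differentiable (by simp) r).hasDerivAt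

theorem hasDerivAt_dt {χ : ℝ × ℝ → ℝ} (hχ : ContDiff ℝ ∞ χ) (r t : ℝ) :
    HasDerivAt (fun s => χ (r, s)) (dt χ (r, t)) t := by
  have h : ContDiff ℝ ∞ (fun s : ℝ => χ (r, s)) := by fun_prop
  exact (h.differentiable (by simp) t).hasDerivAt

theorem contDiff_dr {χ : ℝ × ℝ → ℝ} (hχ : ContDiff ℝ ∞ χ) : ContDiff ℝ ∞ (dr χ) := by
  have h : dr χ = fun q => fderiv ℝ χ q (1, 0) := by
    funext q
    have h1 : HasDerivAt (fun s : ℝ => (s, q.2)) ((1 : ℝ), (0 : ℝ)) q.1 :=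
      (hasDerivAt_id _).prodMk (hasDerivAt_const _ _)
    have h2 : HasFDerivAt χ (fderiv ℝ χ q) (q.1, q.2) :=
      (hχ.differentiable (by simp) q).hasFDerivAt
    exact (h2.comp_hasDerivAt q.1 h1).deriv
  rw [h]
  exact (hχ.fderiv_right (by simp)).clm_apply contDiff_const

theorem contDiff_dt {χ : ℝ × ℝ → ℝ} (hχ : ContDiff ℝ ∞ χ) : ContDiff ℝ ∞ (dt χ) := by
  have h : dt χ = fun q => fderiv ℝ χ q (0, 1) := by
    funext q
    have h1 : HasDerivAt (fun s : ℝ => (q.1, s)) ((0 : ℝ), (1 : ℝ)) q.2 :=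
      (hasDerivAt_const _ _).prodMk (hasDerivAt_id _)
    have h2 : HasFDerivAt χ (fderiv ℝ χ q) (q.1, q.2) :=
      (hχ.differentiable (by simp) q).hasFDerivAt
    exact (h2.comp_hasDerivAt q.2 h1).deriv
  rw [h]
  exact (hχ.fderiv_right (by simp)).clm_apply contDiff_const

/-- Conjugation by `r ^ m`, `m = (n - 1) / 2`, removes the first order term of `adjointOp n`. -/
theorem adjointOp_rpow_mul (n : ℕ) {χ : ℝ × ℝ → ℝ} (hχ : ContDiff ℝ ∞ χ) {q : ℝ × ℝ}
    (hq : 0 < q.1) :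
    adjointOp n (fun z => z.1 ^ halfDim n * χ z) q = q.1 ^ halfDim n * reducedOp n χ q := by
  obtain ⟨r, t⟩ := q
  simp only at hq
  set m := halfDim n with hm
  have hn : (n : ℝ) - 1 = 2 * m := by rw [hm, halfDim]; ring
  have htt : dt (dt (fun z => z.1 ^ m * χ z)) (r, t) = r ^ m * dt (dt χ) (r, t) := by
    have h1 : dt (fun z => z.1 ^ m * χ z) = fun z => z.1 ^ m * dt χ z := by
      funext z
      exact ((hasDerivAt_dt hχ z.1 z.2).const_mul (z.1 ^ m)).deriv
    rw [h1]
    exact ((hasDerivAt_dt (contDiff_dt hχ) r t).const_mul (r ^ m)).deriv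
  have hd : ∀ a s : ℝ, 0 < s → HasDerivAt (fun x : ℝ => x ^ a) (a * s ^ (a - 1)) s :=
    fun a s hs => Real.hasDerivAt_rpow_const (Or.inl hs.ne')
  have hpos : ∀ᶠ z in 𝓝 (r, t), 0 < z.1 :=
    (isOpen_lt continuous_const continuous_fst).mem_nhds hq
  have hdr : ∀ a : ℝ, dr (fun z => z.1 ^ a * χ z) =ᶠ[𝓝 (r, t)]
      fun z => a * z.1 ^ (a - 1) * χ z + z.1 ^ a * dr χ z := by
    intro a
    filter_upwards [hpos] with z hz
    exact ((hd a z.1 hz).mul (hasDerivAt_dr hχ z.1 z.2)).deriv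
  have hrr : dr (dr (fun z => z.1 ^ m * χ z)) (r, t) =
      m * ((m - 1) * r ^ (m - 1 - 1) * χ (r, t) + r ^ (m - 1) * dr χ (r, t)) +
        (m * r ^ (m - 1) * dr χ (r, t) + r ^ m * dr (dr χ) (r, t)) := by
    rw [(dr_congr (hdr m)).eq_of_nhds]
    have h1 := (((hd (m - 1) r hq).mul (hasDerivAt_dr hχ r t)).const_mul m).add
      ((hd m r hq).mul (hasDerivAt_dr (contDiff_dr hχ) r t))
    refine HasDerivAt.deriv (h1.congr_of_eventuallyEq (Eventually.of_forall fun s => ?_))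
    simp only [Pi.add_apply, Pi.mul_apply]
    ring
  have hfirst : dr (fun z => ((n : ℝ) - 1) / z.1 * (z.1 ^ m * χ z)) (r, t) =
      2 * m * ((m - 1) * r ^ (m - 1 - 1) * χ (r, t) + r ^ (m - 1) * dr χ (r, t)) := by
    have h0 : (fun z : ℝ × ℝ => ((n : ℝ) - 1) / z.1 * (z.1 ^ m * χ z)) =ᶠ[𝓝 (r, t)]
        fun z => 2 * m * (z.1 ^ (m - 1) * χ z) := by
      filter_upwards [hpos] with z hz
      rw [hn, Real.rpow_sub_one hz.ne']
      ring
    rw [(dr_congr h0).eq_of_nhds]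
    exact (((hd (m - 1) r hq).mul (hasDerivAt_dr hχ r t)).const_mul (2 * m)).deriv
  unfold adjointOp reducedOp
  rw [htt, hrr, hfirst]
  have e2 : r ^ (m - 1 - 1) = r ^ m / r ^ 2 := by
    rw [Real.rpow_sub_one hq.ne', Real.rpow_sub_one hq.ne']; field_simp
  rw [e2]
  ring

/-! ### The weak formulation of the conjugated equation -/

theorem measurableSet_region (R T : ℝ) : MeasurableSet (region R T) := by
  simp only [region, ofPred_and]
  exact (measurableSet_lt (by fun_prop) (by fun_prop)).inter
    ((measurableSet_le (by fun_prop) (by fun_prop)).inter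
      (measurableSet_lt (by fun_prop) (by fun_prop)))

/-- The weak formulation for `r ^ m * u`. Test functions need only be supported in a truncated
characteristic wedge, which is unbounded as `t → -∞`: what happens for `t < 0` is immaterial. -/
theorem IsSolution.reduced_identity {n : ℕ} {R T : ℝ} {g : ℝ → ℝ → ℝ} {ψ : ℝ → ℝ}
    {u : ℝ × ℝ → ℝ} (hu : IsSolution n R T g ψ u) (hR : 0 < R) {χ : ℝ × ℝ → ℝ}
    (hχ : ContDiff ℝ ∞ χ) {ξ η T' : ℝ} (hξ : R < ξ) (hT' : T' < T)
    (hsupp : ∀ q, χ q ≠ 0 → ξ ≤ q.1 - q.2 ∧ q.1 + q.2 ≤ η ∧ q.2 ≤ T') :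
    (∫ q in region R T, q.1 ^ halfDim n * u q * reducedOp n χ q) =
      (∫ q in region R T, q.1 ^ halfDim n * g q.1 (u q) * χ q) +
        ∫ r in Ioi R, r ^ halfDim n * ψ r * χ (r, 0) := by
  -- The cutoff is `1` for `t ≥ -R / 4` and `0` for `t ≤ -R / 2`, where `r ≥ R / 2` still holds.
  set θ : ℝ → ℝ := fun t => Real.smoothTransition (4 * t / R + 2) with hθ
  have hθs : ContDiff ℝ ∞ θ := by
    refine Real.smoothTransition.contDiff.comp ?_
    fun_prop
  have hθ0 : ∀ t, θ t ≠ 0 → -R / 2 ≤ t := by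
    intro t ht
    by_contra hlt
    push Not at hlt
    refine ht (Real.smoothTransition.zero_of_nonpos ?_)
    have : 4 * t / R ≤ -2 := by rw [div_le_iff₀ hR]; linarith
    linarith
  have hθ1 : ∀ t, -R / 4 ≤ t → θ t = 1 := by
    intro t ht
    refine Real.smoothTransition.one_of_one_le ?_
    have : -1 ≤ 4 * t / R := by rw [le_div_iff₀ hR]; linarith
    linarith
  set φ : ℝ × ℝ → ℝ := fun q => θ q.2 * (q.1 ^ halfDim n * χ q) with hφ
  set K : Set (ℝ × ℝ) :=
    {q | (ξ ≤ q.1 - q.2 ∧ q.1 + q.2 ≤ η) ∧ (q.2 ≤ T' ∧ -R / 2 ≤ q.2)} with hK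
  have hsupK : Function.support φ ⊆ K := by
    intro q hq
    have h1 : θ q.2 ≠ 0 := left_ne_zero_of_mul hq
    have h2 : χ q ≠ 0 := right_ne_zero_of_mul (right_ne_zero_of_mul hq)
    obtain ⟨a, b, c⟩ := hsupp q h2
    exact ⟨⟨a, b⟩, c, hθ0 _ h1⟩
  have hKclosed : IsClosed K := by
    simp only [hK, ofPred_and]
    exact ((isClosed_le (by fun_prop) (by fun_prop)).inter
      (isClosed_le (by fun_prop) (by fun_prop))).inter
      ((isClosed_le (by fun_prop) (by fun_prop)).inter
      (isClosed_le (by fun_prop) (by fun_prop)))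
  have hKcomp : IsCompact K := by
    refine (isCompact_Icc (a := ((0 : ℝ), -R / 2)) (b := (η + R / 2, T'))).of_isClosed_subset
      hKclosed ?_
    rintro ⟨r, t⟩ ⟨⟨h1, h2⟩, h3, h4⟩
    simp only at h1 h2 h3 h4
    exact ⟨⟨by simp only; linarith, h4⟩, ⟨by simp only; linarith, h3⟩⟩
  have htsup : tsupport φ ⊆ K := closure_minimal hsupK hKclosed
  have hφs : ContDiff ℝ ∞ φ := by
    rw [contDiff_iff_contDiffAt]
    rintro ⟨r, t⟩
    by_cases hr : 0 < r
    · have h1 : ContDiffAt ℝ ∞ (fun q : ℝ × ℝ => q.1 ^ halfDim n) (r, t) :=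
        contDiffAt_fst.rpow_const_of_ne hr.ne'
      exact (hθs.comp contDiff_snd).contDiffAt.mul (h1.mul hχ.contDiffAt)
    · have h0 : φ =ᶠ[𝓝 (r, t)] fun _ => 0 := by
        have : (r, t) ∉ tsupport φ := by
          intro h
          obtain ⟨⟨h1, h2⟩, h3, h4⟩ := htsup h
          simp only at h1 h2 h3 h4
          linarith
        exact notMem_tsupport_iff_eventuallyEq.1 this
      exact contDiffAt_const.congr_of_eventuallyEq h0
  have htest : IsTest {q | q.2 + R < q.1 ∧ q.2 < T} φ := by
    refine ⟨hφs, hKcomp.of_isClosed_subset (isClosed_tsupport _) htsup, fun q hq => ?_⟩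
    obtain ⟨⟨h1, h2⟩, h3, h4⟩ := htsup hq
    exact ⟨by linarith, by linarith⟩
  have hid := hu.equation φ htest
  have e1 : (∫ q in region R T, u q * adjointOp n φ q) =
      ∫ q in region R T, q.1 ^ halfDim n * u q * reducedOp n χ q := by
    refine setIntegral_congr_fun (measurableSet_region R T) fun q hq => ?_
    obtain ⟨h1, h2, h3⟩ := hq
    have hloc : φ =ᶠ[𝓝 q] fun z => z.1 ^ halfDim n * χ z := by
      have : ∀ᶠ z : ℝ × ℝ in 𝓝 q, -R / 4 < z.2 :=
        (isOpen_lt continuous_const continuous_snd).mem_nhds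
          (show -R / 4 < q.2 by linarith)
      filter_upwards [this] with z hz
      rw [hφ]
      simp only
      rw [hθ1 _ hz.le, one_mul]
    rw [adjointOp_congr n hloc, adjointOp_rpow_mul n hχ (by linarith)]
    ring
  have e2 : (∫ q in region R T, g q.1 (u q) * φ q) =
      ∫ q in region R T, q.1 ^ halfDim n * g q.1 (u q) * χ q := by
    refine setIntegral_congr_fun (measurableSet_region R T) fun q hq => ?_
    obtain ⟨h1, h2, h3⟩ := hq
    simp only [hφ]
    rw [hθ1 _ (by linarith)]
    ring
  have e3 : (∫ r in Ioi R, ψ r * φ (r, 0)) =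
      ∫ r in Ioi R, r ^ halfDim n * ψ r * χ (r, 0) := by
    refine setIntegral_congr_fun measurableSet_Ioi fun r _ => ?_
    simp only [hφ]
    rw [hθ1 _ (by linarith)]
    ring
  rw [← e1, ← e2, ← e3, hid]

/-! ### Test functions in characteristic coordinates -/

/-- A smooth monotone step from `0` on `(-∞, 0]` to `1` on `[δ, ∞)`, with its primitive. -/
theorem exists_step {δ : ℝ} (hδ : 0 < δ) : ∃ s s₁ : ℝ → ℝ, ContDiff ℝ ∞ s ∧ ContDiff ℝ ∞ s₁ ∧
    deriv s₁ = s ∧ (∀ x, 0 ≤ s x ∧ s x ≤ 1) ∧ (∀ x ≤ 0, s x = 0 ∧ s₁ x = 0) ∧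
    (∀ x, 0 ≤ x → 0 ≤ s₁ x ∧ s₁ x ≤ x * s x) ∧ (∀ x, 0 ≤ deriv s x) ∧
    (∀ x, deriv s x ≠ 0 → x ∈ Icc 0 δ) ∧ ∫ x, deriv s x = 1 := by
  set s : ℝ → ℝ := fun x => Real.smoothTransition (x / δ) with hs
  have hsm : ContDiff ℝ ∞ s := Real.smoothTransition.contDiff.comp (by fun_prop)
  have hmono : Monotone s := fun x y hxy =>
    Real.smoothTransition.monotone (div_le_div_of_nonneg_right hxy hδ.le)
  have h0 : ∀ x ≤ 0, s x = 0 := fun x hx =>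
    Real.smoothTransition.zero_of_nonpos (div_nonpos_of_nonpos_of_nonneg hx hδ.le)
  have h1 : ∀ x, δ ≤ x → s x = 1 := fun x hx =>
    Real.smoothTransition.one_of_one_le ((one_le_div hδ).2 hx)
  have hb : ∀ x, 0 ≤ s x ∧ s x ≤ 1 := fun x =>
    ⟨Real.smoothTransition.nonneg _, Real.smoothTransition.le_one _⟩
  set s₁ : ℝ → ℝ := fun x => ∫ y in (0 : ℝ)..x, s y with hs₁
  have hd : ∀ x, HasDerivAt s₁ (s x) x := fun x =>
    intervalIntegral.integral_hasDerivAt_right (hsm.continuous.intervalIntegrable _ _)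
      (hsm.continuous.stronglyMeasurableAtFilter _ _) hsm.continuous.continuousAt
  have hd' : deriv s₁ = s := funext fun x => (hd x).deriv
  have hsupp : ∀ x, deriv s x ≠ 0 → x ∈ Icc 0 δ := by
    intro x hx
    by_contra hmem
    apply hx
    rcases lt_or_ge x 0 with hlt | hge
    · have : s =ᶠ[𝓝 x] fun _ => 0 := by
        filter_upwards [Iio_mem_nhds hlt] with y hy using h0 y (le_of_lt hy)
      rw [this.deriv_eq, deriv_const]
    · have hgt : δ < x := by
        by_contra hle
        exact hmem ⟨hge, not_lt.1 hle⟩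
      have : s =ᶠ[𝓝 x] fun _ => 1 := by
        filter_upwards [Ioi_mem_nhds hgt] with y hy using h1 y (le_of_lt hy)
      rw [this.deriv_eq, deriv_const]
  refine ⟨s, s₁, hsm, ?_, hd', hb, fun x hx => ⟨h0 x hx, ?_⟩, fun x hx => ⟨?_, ?_⟩,
    fun x => hmono.deriv_nonneg, hsupp, ?_⟩
  · rw [contDiff_infty_iff_deriv]
    exact ⟨fun x => (hd x).differentiableAt, by rw [hd']; exact hsm⟩
  · rw [hs₁]
    simp only
    rw [intervalIntegral.integral_symm, intervalIntegral.integral_congr (g := fun _ => 0)]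
    · simp
    · intro y hy
      rw [uIcc_of_le hx] at hy
      exact h0 y hy.2
  · exact intervalIntegral.integral_nonneg hx fun y _ => (hb y).1
  · have : s₁ x ≤ ∫ y in (0 : ℝ)..x, s x :=
      intervalIntegral.integral_mono_on hx (hsm.continuous.intervalIntegrable _ _)
        (continuous_const.intervalIntegrable _ _) fun y hy => hmono hy.2
    simpa using this
  · have hc : Continuous (deriv s) := hsm.continuous_deriv (by simp)
    have : ∫ x in Icc 0 δ, deriv s x = ∫ x, deriv s x :=
      setIntegral_eq_integral_of_forall_compl_eq_zero fun x hx => by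
        by_contra hne
        exact hx (hsupp x hne)
    rw [← this, integral_Icc_eq_integral_Ioc, ← intervalIntegral.integral_of_le hδ.le,
      intervalIntegral.integral_deriv_eq_sub
        (fun x _ => hsm.differentiable (by simp) x) (hc.intervalIntegrable _ _),
      h1 δ le_rfl, h0 0 le_rfl, sub_zero]

/-- The d'Alembertian of a product of functions of the two characteristic variables. -/
theorem dt_dt_sub_dr_dr_characteristic {f : ℝ → ℝ} (hf : ContDiff ℝ ∞ f) (ξ η : ℝ) (q : ℝ × ℝ) :
    dt (dt fun z => f (z.1 - z.2 - ξ) * f (η - z.1 - z.2)) q -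
      dr (dr fun z => f (z.1 - z.2 - ξ) * f (η - z.1 - z.2)) q =
      4 * (deriv f (q.1 - q.2 - ξ) * deriv f (η - q.1 - q.2)) := by
  have hf' : ContDiff ℝ ∞ (deriv f) := (contDiff_infty_iff_deriv.1 hf).2
  have D : ∀ {h : ℝ → ℝ}, ContDiff ℝ ∞ h → ∀ x, HasDerivAt h (deriv h x) x :=
    fun hh x => (hh.differentiable (by simp) x).hasDerivAt
  have xt : ∀ r t : ℝ, HasDerivAt (fun s => r - s - ξ) (-1) t := fun r t => by
    simpa using ((hasDerivAt_id t).const_sub r).sub_const ξ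
  have yt : ∀ r t : ℝ, HasDerivAt (fun s => η - r - s) (-1) t := fun r t => by
    simpa using (hasDerivAt_id t).const_sub (η - r)
  have xr : ∀ r t : ℝ, HasDerivAt (fun s => s - t - ξ) 1 r := fun r t => by
    simpa using ((hasDerivAt_id r).sub_const t).sub_const ξ
  have yr : ∀ r t : ℝ, HasDerivAt (fun s => η - s - t) (-1) r := fun r t => by
    simpa using ((hasDerivAt_id r).const_sub η).sub_const t
  have h1 : dt (fun z => f (z.1 - z.2 - ξ) * f (η - z.1 - z.2)) =
      fun z => -(deriv f (z.1 - z.2 - ξ) * f (η - z.1 - z.2)) -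
        f (z.1 - z.2 - ξ) * deriv f (η - z.1 - z.2) := by
    funext z
    refine (((D hf _).comp z.2 (xt z.1 z.2)).mul ((D hf _).comp z.2 (yt z.1 z.2))).deriv.trans ?_
    simp only [Function.comp_apply]
    ring
  have h2 : dr (fun z => f (z.1 - z.2 - ξ) * f (η - z.1 - z.2)) =
      fun z => deriv f (z.1 - z.2 - ξ) * f (η - z.1 - z.2) -
        f (z.1 - z.2 - ξ) * deriv f (η - z.1 - z.2) := by
    funext z
    refine (((D hf _).comp z.1 (xr z.1 z.2)).mul ((D hf _).comp z.1 (yr z.1 z.2))).deriv.trans ?_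
    simp only [Function.comp_apply]
    ring
  have h3 := ((((D hf' _).comp q.2 (xt q.1 q.2)).mul ((D hf _).comp q.2 (yt q.1 q.2))).neg.sub
    (((D hf _).comp q.2 (xt q.1 q.2)).mul ((D hf' _).comp q.2 (yt q.1 q.2)))).deriv
  have h4 := ((((D hf' _).comp q.1 (xr q.1 q.2)).mul ((D hf _).comp q.1 (yr q.1 q.2))).sub
    (((D hf _).comp q.1 (xr q.1 q.2)).mul ((D hf' _).comp q.1 (yr q.1 q.2)))).deriv
  rw [h1, h2]
  refine (congrArg₂ (· - ·) h3 h4).trans ?_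
  simp only [Function.comp_apply]
  ring

theorem dt_sub_const_mul {φ φ' : ℝ × ℝ → ℝ} (h : ContDiff ℝ ∞ φ) (h' : ContDiff ℝ ∞ φ') (β : ℝ) :
    dt (fun q => φ q - β * φ' q) = fun q => dt φ q - β * dt φ' q :=
  funext fun q => ((hasDerivAt_dt h q.1 q.2).sub ((hasDerivAt_dt h' q.1 q.2).const_mul β)).deriv

theorem dr_sub_const_mul {φ φ' : ℝ × ℝ → ℝ} (h : ContDiff ℝ ∞ φ) (h' : ContDiff ℝ ∞ φ') (β : ℝ) :
    dr (fun q => φ q - β * φ' q) = fun q => dr φ q - β * dr φ' q :=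
  funext fun q => ((hasDerivAt_dr h q.1 q.2).sub ((hasDerivAt_dr h' q.1 q.2).const_mul β)).deriv

theorem hasCompactSupport_of_forall_mem_Icc {f : ℝ × ℝ → ℝ} (a b : ℝ × ℝ)
    (h : ∀ q, f q ≠ 0 → q ∈ Icc a b) : HasCompactSupport f :=
  HasCompactSupport.of_support_subset_isCompact isCompact_Icc fun q hq => h q hq

/-- The factor `1 / 2` is the Jacobian of the characteristic coordinates. -/
theorem integral_characteristic {f : ℝ → ℝ} (hf : Continuous f) {δ : ℝ}
    (hsupp : ∀ x, f x ≠ 0 → x ∈ Icc 0 δ) (ξ η : ℝ) :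
    ∫ q : ℝ × ℝ, f (q.1 - q.2 - ξ) * f (η - q.1 - q.2) = (∫ x, f x) * (∫ x, f x) / 2 := by
  have hint : Integrable (fun q : ℝ × ℝ => f (q.1 - q.2 - ξ) * f (η - q.1 - q.2)) := by
    refine Continuous.integrable_of_hasCompactSupport (by fun_prop)
      (hasCompactSupport_of_forall_mem_Icc ((ξ + η - δ) / 2, (η - ξ) / 2 - δ)
        ((ξ + η + δ) / 2, (η - ξ) / 2) ?_)
    rintro ⟨r, t⟩ hq
    obtain ⟨h1, h2⟩ := hsupp _ (left_ne_zero_of_mul hq)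
    obtain ⟨h3, h4⟩ := hsupp _ (right_ne_zero_of_mul hq)
    simp only at h1 h2 h3 h4
    exact ⟨⟨by simp only; linarith, by simp only; linarith⟩,
      ⟨by simp only; linarith, by simp only; linarith⟩⟩
  have hint' : Integrable
      (Function.uncurry fun t x : ℝ => f x * f (η - ξ - x - 2 * t)) (volume.prod volume) := by
    rw [← Measure.volume_eq_prod]
    refine Continuous.integrable_of_hasCompactSupport
      (by unfold Function.uncurry; fun_prop)
      (hasCompactSupport_of_forall_mem_Icc ((η - ξ) / 2 - δ, 0) ((η - ξ) / 2, δ) ?_)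
    rintro ⟨t, x⟩ hq
    obtain ⟨h1, h2⟩ := hsupp _ (left_ne_zero_of_mul hq)
    obtain ⟨h3, h4⟩ := hsupp _ (right_ne_zero_of_mul hq)
    simp only at h1 h2 h3 h4
    exact ⟨⟨by simp only; linarith, by simp only; linarith⟩,
      ⟨by simp only; linarith, by simp only; linarith⟩⟩
  rw [Measure.volume_eq_prod] at hint ⊢
  rw [integral_prod_symm _ hint]
  have hinner : ∀ t : ℝ, ∫ r : ℝ, f (r - t - ξ) * f (η - r - t) =
      ∫ x : ℝ, f x * f (η - ξ - x - 2 * t) := by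
    intro t
    rw [← integral_add_right_eq_self (fun r : ℝ => f (r - t - ξ) * f (η - r - t)) (t + ξ)]
    congr 1
    funext x
    congr 2 <;> ring
  simp only [hinner]
  rw [integral_integral_swap hint']
  have hhalf : ∀ x : ℝ, ∫ t : ℝ, f x * f (η - ξ - x - 2 * t) = f x * ((∫ y, f y) / 2) := by
    intro x
    rw [integral_const_mul]
    have h1 := Measure.integral_comp_mul_left (fun y : ℝ => f (η - ξ - x - y)) 2
    rw [h1, integral_sub_left_eq_self f volume (η - ξ - x), abs_of_pos (by norm_num), smul_eq_mul]
    ring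
  simp only [hhalf]
  rw [integral_mul_const]
  ring

/-! ### Characteristic triangles -/

/-- The truncated backward characteristic triangle with base `[ξ, η]` on the line `t = 0`. -/
def triangle (ξ η : ℝ) : Set (ℝ × ℝ) := {q | (ξ ≤ q.1 - q.2 ∧ q.1 + q.2 ≤ η) ∧ 0 ≤ q.2}

theorem isCompact_triangle (ξ η : ℝ) : IsCompact (triangle ξ η) := by
  refine (isCompact_Icc (a := (ξ, (0 : ℝ))) (b := (η, (η - ξ) / 2))).of_isClosed_subset ?_ ?_
  · simp only [triangle, ofPred_and]
    exact ((isClosed_le (by fun_prop) (by fun_prop)).inter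
      (isClosed_le (by fun_prop) (by fun_prop))).inter
      (isClosed_le (by fun_prop) (by fun_prop))
  · rintro ⟨r, t⟩ ⟨⟨h1, h2⟩, h3⟩
    simp only at h1 h2 h3
    exact ⟨⟨by simp only; linarith, h3⟩, ⟨by simp only; linarith, by simp only; linarith⟩⟩

theorem triangle_subset_triangle {ξ η ξ' η' : ℝ} (hξ : ξ ≤ ξ') (hη : η' ≤ η) :
    triangle ξ' η' ⊆ triangle ξ η :=
  fun _ hq => ⟨⟨hξ.trans hq.1.1, hq.1.2.trans hη⟩, hq.2⟩

theorem triangle_subset_region {R T ξ η : ℝ} (hξ : R < ξ) (hT : η - ξ < 2 * T) :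
    triangle ξ η ⊆ region R T :=
  fun q hq => ⟨by linarith [hq.1.1], hq.2, by linarith [hq.1.1, hq.1.2]⟩

theorem setIntegral_exp_triangle_le {l : ℝ} (hl : 0 < l) {ξ η : ℝ} (h : ξ ≤ η) :
    ∫ q in triangle ξ η, Real.exp (l * q.2) ≤ (η - ξ) * (Real.exp (l * ((η - ξ) / 2)) / l) := by
  have hc : Continuous fun q : ℝ × ℝ => Real.exp (l * q.2) := by fun_prop
  have hsub : triangle ξ η ⊆ Icc ξ η ×ˢ Icc 0 ((η - ξ) / 2) := by
    rintro ⟨r, t⟩ ⟨⟨h1, h2⟩, h3⟩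
    simp only at h1 h2 h3
    exact ⟨⟨by simp only; linarith, by simp only; linarith⟩, ⟨h3, by simp only; linarith⟩⟩
  have hle : ∫ q in triangle ξ η, Real.exp (l * q.2) ≤
      ∫ q in Icc ξ η ×ˢ Icc 0 ((η - ξ) / 2), Real.exp (l * q.2) :=
    setIntegral_mono_set (hc.continuousOn.integrableOn_compact (isCompact_Icc.prod isCompact_Icc))
      (Eventually.of_forall fun _ => (Real.exp_pos _).le) hsub.eventuallyLE
  refine hle.trans ?_
  have hprod := setIntegral_prod_mul (μ := (volume : Measure ℝ)) (ν := (volume : Measure ℝ))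
    (fun _ : ℝ => (1 : ℝ)) (fun t : ℝ => Real.exp (l * t)) (Icc ξ η) (Icc 0 ((η - ξ) / 2))
  simp only [one_mul] at hprod
  rw [Measure.volume_eq_prod, hprod]
  have h1 : ∫ _ in Icc ξ η, (1 : ℝ) = η - ξ := by simp [h]
  have h2 : ∫ t in Icc 0 ((η - ξ) / 2), Real.exp (l * t) ≤ Real.exp (l * ((η - ξ) / 2)) / l := by
    rw [integral_Icc_eq_integral_Ioc, ← intervalIntegral.integral_of_le (by linarith),
      intervalIntegral.integral_comp_mul_left (fun t => Real.exp t) hl.ne', integral_exp,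
      smul_eq_mul, mul_zero, Real.exp_zero, inv_mul_eq_div]
    gcongr
    linarith
  rw [h1]
  exact mul_le_mul_of_nonneg_left h2 (by linarith)

/-! ### Positivity of solutions -/

theorem abs_potential_le {n : ℕ} (hn : 1 ≤ n) : |halfDim n * (halfDim n - 1)| ≤ (n : ℝ) ^ 2 := by
  have h1 : (1 : ℝ) ≤ n := by exact_mod_cast hn
  unfold halfDim
  rw [abs_le]
  constructor <;> nlinarith

/-- In a short enough backward characteristic triangle there is a nonnegative test function `χ`
for which `reducedOp n χ` is an approximate delta function `κ` at the vertex minus a bounded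
nonnegative remainder, whatever the sign of the potential. Approximately, `χ = 1 - β x y` in the
triangle, where `x` and `y` are the characteristic coordinates measured from the vertex: the
correction vanishes on both sides of the triangle, so no further singular terms arise there. -/
theorem exists_triangle_test {n : ℕ} (hn : 1 ≤ n) {ξ ξ₀ η₀ δ : ℝ} (hξ : 0 < ξ) (hξ₀ : ξ ≤ ξ₀)
    (hcone : n * ((η₀ - ξ₀) / 2) ≤ ξ) (hδ : 0 < δ) (hδ' : δ ≤ (η₀ - ξ₀) / 2) :
    ∃ χ κ : ℝ × ℝ → ℝ, ContDiff ℝ ∞ χ ∧ Continuous κ ∧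
      (∀ q, q.1 - q.2 < ξ₀ ∨ η₀ < q.1 + q.2 → χ q = 0 ∧ reducedOp n χ q = 0) ∧
      (∀ q ∈ triangle ξ₀ η₀, 0 ≤ χ q ∧ χ q ≤ 1 ∧ 0 ≤ κ q ∧ 0 ≤ κ q - reducedOp n χ q ∧
        κ q - reducedOp n χ q ≤ 8 * (|halfDim n * (halfDim n - 1)| / (4 * ξ ^ 2))) ∧
      (∀ q, κ q ≠ 0 → |q.1 - (ξ₀ + η₀) / 2| ≤ δ ∧ |q.2 - (η₀ - ξ₀) / 2| ≤ δ) ∧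
      ∫ q in triangle ξ₀ η₀, κ q = 2 := by
  set c := halfDim n * (halfDim n - 1) with hc
  set β := |c| / (4 * ξ ^ 2) with hβ
  set t := (η₀ - ξ₀) / 2 with ht
  have ht0 : 0 < t := hδ.trans_le hδ'
  have hβ0 : 0 ≤ β := by positivity
  have hβt : β * t ^ 2 ≤ 1 := by
    rw [hβ, div_mul_eq_mul_div, div_le_one (by positivity)]
    have h1 : |c| * t ^ 2 ≤ (n : ℝ) ^ 2 * t ^ 2 :=
      mul_le_mul_of_nonneg_right (abs_potential_le hn) (by positivity)
    have h2 : ((n : ℝ) * t) ^ 2 ≤ ξ ^ 2 := pow_le_pow_left₀ (by positivity) hcone 2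
    nlinarith
  obtain ⟨s, s₁, hs, hs₁, hds₁, hs01, hsneg, hspos, hds0, hdsupp, hdint⟩ := exists_step hδ
  have hds : ContDiff ℝ ∞ (deriv s) := (contDiff_infty_iff_deriv.1 hs).2
  have hdsc : Continuous (deriv s) := hds.continuous
  set χ : ℝ × ℝ → ℝ := fun q => s (q.1 - q.2 - ξ₀) * s (η₀ - q.1 - q.2) -
    β * (s₁ (q.1 - q.2 - ξ₀) * s₁ (η₀ - q.1 - q.2)) with hχ
  set κ : ℝ × ℝ → ℝ :=
    fun q => 4 * (deriv s (q.1 - q.2 - ξ₀) * deriv s (η₀ - q.1 - q.2)) with hκ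
  have hss : ContDiff ℝ ∞ fun q : ℝ × ℝ => s (q.1 - q.2 - ξ₀) * s (η₀ - q.1 - q.2) := by fun_prop
  have hss₁ : ContDiff ℝ ∞ fun q : ℝ × ℝ => s₁ (q.1 - q.2 - ξ₀) * s₁ (η₀ - q.1 - q.2) := by
    fun_prop
  have hred : ∀ q, reducedOp n χ q =
      κ q - 4 * β * (s (q.1 - q.2 - ξ₀) * s (η₀ - q.1 - q.2)) + c / q.1 ^ 2 * χ q := by
    intro q
    have h1 := dt_dt_sub_dr_dr_characteristic hs ξ₀ η₀ q
    have h2 := dt_dt_sub_dr_dr_characteristic hs₁ ξ₀ η₀ q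
    rw [hds₁] at h2
    unfold reducedOp
    rw [← hc, hχ, dt_sub_const_mul hss hss₁, dr_sub_const_mul hss hss₁,
      dt_sub_const_mul (contDiff_dt hss) (contDiff_dt hss₁),
      dr_sub_const_mul (contDiff_dr hss) (contDiff_dr hss₁)]
    linear_combination h1 - β * h2
  have hd0 : ∀ x < 0, deriv s x = 0 := fun x hx => by
    by_contra h
    exact absurd (hdsupp x h).1 (not_le.2 hx)
  refine ⟨χ, κ, hss.sub (contDiff_const.mul hss₁), by fun_prop, ?_, ?_, ?_, ?_⟩
  · rintro q (h | h)
    · have h1 : q.1 - q.2 - ξ₀ < 0 := by linarith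
      have h2 := hsneg _ h1.le
      rw [hred]
      simp [hχ, hκ, h2.1, h2.2, hd0 _ h1]
    · have h1 : η₀ - q.1 - q.2 < 0 := by linarith
      have h2 := hsneg _ h1.le
      rw [hred]
      simp [hχ, hκ, h2.1, h2.2, hd0 _ h1]
  · intro q hq
    obtain ⟨⟨h1, h2⟩, h3⟩ := hq
    have hx : 0 ≤ q.1 - q.2 - ξ₀ := by linarith
    have hy : 0 ≤ η₀ - q.1 - q.2 := by linarith
    have hxy : (q.1 - q.2 - ξ₀) * (η₀ - q.1 - q.2) ≤ t ^ 2 := by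
      have h4 : (q.1 - q.2 - ξ₀) + (η₀ - q.1 - q.2) ≤ 2 * t := by linarith
      nlinarith [sq_nonneg ((q.1 - q.2 - ξ₀) - (η₀ - q.1 - q.2))]
    have hpot : |c / q.1 ^ 2| ≤ 4 * β := by
      have hq1 : ξ ≤ q.1 := by linarith
      rw [abs_div, abs_of_pos (pow_pos (hξ.trans_le hq1) 2 : 0 < q.1 ^ 2), hβ]
      have h1 : ξ ^ 2 ≤ q.1 ^ 2 := pow_le_pow_left₀ hξ.le hq1 2
      calc |c| / q.1 ^ 2 ≤ |c| / ξ ^ 2 := by gcongr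
        _ = 4 * (|c| / (4 * ξ ^ 2)) := by field_simp
    obtain ⟨hpot1, hpot2⟩ := abs_le.1 hpot
    have hχ01 : 0 ≤ χ q ∧ χ q ≤ s (q.1 - q.2 - ξ₀) * s (η₀ - q.1 - q.2) := by
      simp only [hχ]
      generalize q.1 - q.2 - ξ₀ = x at hx hxy ⊢
      generalize η₀ - q.1 - q.2 = y at hy hxy ⊢
      have ha := hspos x hx
      have hb := hspos y hy
      have hp : s₁ x * s₁ y ≤ (x * s x) * (y * s y) :=
        mul_le_mul ha.2 hb.2 hb.1 (ha.1.trans ha.2)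
      have hsxy : 0 ≤ s x * s y := mul_nonneg (hs01 x).1 (hs01 y).1
      have h5 : β * (x * y) ≤ 1 := (mul_le_mul_of_nonneg_left hxy hβ0).trans hβt
      have h6 := mul_le_mul_of_nonneg_left hp hβ0
      have h7 := mul_le_mul_of_nonneg_right h5 hsxy
      have h8 := mul_nonneg hβ0 (mul_nonneg ha.1 hb.1)
      constructor <;> linarith
    have hss1 : s (q.1 - q.2 - ξ₀) * s (η₀ - q.1 - q.2) ≤ 1 :=
      mul_le_one₀ (hs01 _).2 (hs01 _).1 (hs01 _).2
    have hκ0 : 0 ≤ κ q := mul_nonneg (by norm_num) (mul_nonneg (hds0 _) (hds0 _))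
    have h4 := mul_le_mul_of_nonneg_right hpot2 hχ01.1
    have h5 := mul_le_mul_of_nonneg_right hpot1 hχ01.1
    have h6 := mul_le_mul_of_nonneg_left hχ01.2 hβ0
    have h7 := mul_le_mul_of_nonneg_left hss1 hβ0
    rw [hred]
    refine ⟨hχ01.1, hχ01.2.trans hss1, hκ0, by linarith, by linarith⟩
  · intro q hq
    have hq' := right_ne_zero_of_mul hq
    obtain ⟨h1, h2⟩ := hdsupp _ (left_ne_zero_of_mul hq')
    obtain ⟨h3, h4⟩ := hdsupp _ (right_ne_zero_of_mul hq')
    rw [abs_le, abs_le]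
    refine ⟨⟨?_, ?_⟩, ?_, ?_⟩ <;> linarith
  · have h1 : ∫ q in triangle ξ₀ η₀, κ q = ∫ q : ℝ × ℝ, κ q := by
      refine setIntegral_eq_integral_of_forall_compl_eq_zero fun q hq => ?_
      by_contra h
      have h' := right_ne_zero_of_mul h
      obtain ⟨h1, h2⟩ := hdsupp _ (left_ne_zero_of_mul h')
      obtain ⟨h3, h4⟩ := hdsupp _ (right_ne_zero_of_mul h')
      exact hq ⟨⟨by linarith, by linarith⟩, by linarith⟩
    rw [h1, hκ, integral_const_mul, integral_characteristic hdsc hdsupp, hdint]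
    norm_num

/-- Integral form of the reduced identity: for `χ` supported over a triangle and `ψ ≥ 0`, the
nonnegative boundary term can be dropped. -/
theorem IsSolution.setIntegral_sub_nonpos {n : ℕ} {R T : ℝ} {g : ℝ → ℝ → ℝ} {ψ : ℝ → ℝ}
    {u : ℝ × ℝ → ℝ} (hu : IsSolution n R T g ψ u) (hR : 0 < R)
    (hg : ContinuousOn (fun z : ℝ × ℝ => g z.1 z.2) (Ioi R ×ˢ univ))
    (hψ : ∀ r, R < r → 0 ≤ ψ r) {ξ₀ η₀ : ℝ} (hξ : R < ξ₀) (hT : η₀ - ξ₀ < 2 * T)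
    {χ : ℝ × ℝ → ℝ} (hχ : ContDiff ℝ ∞ χ)
    (hzero : ∀ q, q.1 - q.2 < ξ₀ ∨ η₀ < q.1 + q.2 → χ q = 0 ∧ reducedOp n χ q = 0)
    (hpos : ∀ q ∈ triangle ξ₀ η₀, 0 ≤ χ q) :
    IntegrableOn (fun q => q.1 ^ halfDim n * g q.1 (u q) * χ q -
        q.1 ^ halfDim n * u q * reducedOp n χ q) (triangle ξ₀ η₀) ∧
      ∫ q in triangle ξ₀ η₀, (q.1 ^ halfDim n * g q.1 (u q) * χ q -
        q.1 ^ halfDim n * u q * reducedOp n χ q) ≤ 0 := by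
  have hreg : triangle ξ₀ η₀ ⊆ region R T := triangle_subset_region hξ hT
  have hout : ∀ q ∈ region R T \ triangle ξ₀ η₀, q.1 - q.2 < ξ₀ ∨ η₀ < q.1 + q.2 := by
    rintro q ⟨hq, hq'⟩
    by_contra! h
    exact hq' ⟨h, hq.2.1⟩
  have hsupp : ∀ q, χ q ≠ 0 → ξ₀ ≤ q.1 - q.2 ∧ q.1 + q.2 ≤ η₀ ∧ q.2 ≤ (η₀ - ξ₀) / 2 := by
    intro q hq
    have : ξ₀ ≤ q.1 - q.2 ∧ q.1 + q.2 ≤ η₀ := by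
      by_contra h
      refine hq (hzero q ?_).1
      by_contra! h'
      exact h h'
    exact ⟨this.1, this.2, by linarith [this.1, this.2]⟩
  have hid := hu.reduced_identity hR hχ hξ (by linarith) hsupp
  have hJ : 0 ≤ ∫ r in Ioi R, r ^ halfDim n * ψ r * χ (r, 0) := by
    refine setIntegral_nonneg measurableSet_Ioi fun r hr => ?_
    refine mul_nonneg (mul_nonneg (Real.rpow_nonneg (hR.trans hr).le _) (hψ r hr)) ?_
    by_cases h : (r, (0 : ℝ)) ∈ triangle ξ₀ η₀
    · exact hpos _ h
    · refine (hzero (r, 0) ?_).1.ge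
      by_contra! h'
      exact h ⟨h', le_rfl⟩
  have e1 : ∫ q in region R T, q.1 ^ halfDim n * u q * reducedOp n χ q =
      ∫ q in triangle ξ₀ η₀, q.1 ^ halfDim n * u q * reducedOp n χ q := by
    refine setIntegral_eq_of_subset_of_forall_sdiff_eq_zero (measurableSet_region R T) hreg
      fun q hq => ?_
    rw [(hzero q (hout q hq)).2, mul_zero]
  have e2 : ∫ q in region R T, q.1 ^ halfDim n * g q.1 (u q) * χ q =
      ∫ q in triangle ξ₀ η₀, q.1 ^ halfDim n * g q.1 (u q) * χ q := by
    refine setIntegral_eq_of_subset_of_forall_sdiff_eq_zero (measurableSet_region R T) hreg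
      fun q hq => ?_
    rw [(hzero q (hout q hq)).1, mul_zero]
  rw [e1, e2] at hid
  have hr : ∀ q ∈ triangle ξ₀ η₀, R < q.1 := fun q hq => by linarith [hq.1.1, hq.2]
  have huc : ContinuousOn u (triangle ξ₀ η₀) := hu.continuousOn.mono hreg
  have hrc : ContinuousOn (fun q : ℝ × ℝ => q.1 ^ halfDim n) (triangle ξ₀ η₀) :=
    continuousOn_fst.rpow_const fun q hq => Or.inl (hR.trans (hr q hq)).ne'
  have hi1 : IntegrableOn (fun q => q.1 ^ halfDim n * u q * reducedOp n χ q)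
      (triangle ξ₀ η₀) := by
    refine ContinuousOn.integrableOn_compact (isCompact_triangle _ _) ((hrc.mul huc).mul ?_)
    refine ((contDiff_dt (contDiff_dt hχ)).continuous.sub
      (contDiff_dr (contDiff_dr hχ)).continuous).continuousOn.add (ContinuousOn.mul ?_
      hχ.continuous.continuousOn)
    exact continuousOn_const.div (by fun_prop) fun q hq =>
      pow_ne_zero 2 (hR.trans (hr q hq)).ne'
  have hi2 : IntegrableOn (fun q => q.1 ^ halfDim n * g q.1 (u q) * χ q) (triangle ξ₀ η₀) := by
    refine ContinuousOn.integrableOn_compact (isCompact_triangle _ _) ((hrc.mul ?_).mul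
      hχ.continuous.continuousOn)
    exact hg.comp (continuousOn_fst.prodMk huc) fun q hq => ⟨hr q hq, mem_univ _⟩
  refine ⟨hi2.sub hi1, ?_⟩
  rw [integral_sub hi2 hi1]
  linarith

/-- Positivity of solutions on `n t ≤ r - t`: a negative minimum of `e ^ (-l t) r ^ m u` over the
backward characteristic triangle of a point is impossible for large `l`. -/
theorem IsSolution.nonneg {n : ℕ} {R T : ℝ} {g : ℝ → ℝ → ℝ} {ψ : ℝ → ℝ}
    {u : ℝ × ℝ → ℝ} (hu : IsSolution n R T g ψ u) (hn : 1 ≤ n) (hR : 0 < R)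
    (hg : ContinuousOn (fun z : ℝ × ℝ => g z.1 z.2) (Ioi R ×ˢ univ))
    (hlow : ∀ ξ η N : ℝ, R < ξ → ∃ Λ : ℝ, 0 ≤ Λ ∧
      ∀ r ∈ Icc ξ η, ∀ x ∈ Icc (-N) N, -(Λ * max (-x) 0) ≤ g r x)
    (hψ : ∀ r, R < r → 0 ≤ ψ r) {r t : ℝ} (hrt : R < r - t) (ht : 0 ≤ t) (htT : t < T)
    (hcone : n * t ≤ r - t) : 0 ≤ u (r, t) := by
  by_contra! hneg
  set ξ := r - t with hξ
  set η := r + t with hη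
  have hξ0 : 0 < ξ := hR.trans hrt
  have hDreg : triangle ξ η ⊆ region R T := triangle_subset_region hrt (by linarith)
  have hDpos : ∀ q ∈ triangle ξ η, ξ ≤ q.1 ∧ q.1 ≤ η := fun q hq =>
    ⟨by linarith [hq.1.1, hq.2], by linarith [hq.1.2, hq.2]⟩
  have hPD : (r, t) ∈ triangle ξ η := ⟨⟨le_rfl, le_rfl⟩, ht⟩
  have hrpos : ∀ q ∈ triangle ξ η, 0 < q.1 ^ halfDim n := fun q hq =>
    Real.rpow_pos_of_pos (hξ0.trans_le (hDpos q hq).1) _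
  set v : ℝ × ℝ → ℝ := fun q => q.1 ^ halfDim n * u q with hv
  have hvD : ContinuousOn v (triangle ξ η) :=
    (continuousOn_fst.rpow_const fun q hq => Or.inl (hξ0.trans_le (hDpos q hq).1).ne').mul
      (hu.continuousOn.mono hDreg)
  obtain ⟨N, hN⟩ := hu.locallyBounded _ (isCompact_triangle ξ η) hDreg
  obtain ⟨Λ, hΛ, hgΛ⟩ := hlow ξ η N hrt
  set β := |halfDim n * (halfDim n - 1)| / (4 * ξ ^ 2) with hβ
  have hβ0 : 0 ≤ β := by positivity
  set M := Λ + 8 * β with hM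
  have hM0 : 0 ≤ M := by positivity
  set l := 2 * M * t + 1 with hl
  have hl0 : 0 < l := by positivity
  obtain ⟨⟨r₀, t₀⟩, hP₀, hmin⟩ := (isCompact_triangle ξ η).exists_isMinOn ⟨_, hPD⟩
    (hvD.mul (by fun_prop : ContinuousOn (fun q : ℝ × ℝ => Real.exp (-(l * q.2))) _))
  set S := -(v (r₀, t₀) * Real.exp (-(l * t₀))) with hS
  have hS0 : 0 < S := by
    have h1 : v (r₀, t₀) * Real.exp (-(l * t₀)) ≤ v (r, t) * Real.exp (-(l * t)) := hmin hPD
    have h2 : v (r, t) < 0 := mul_neg_of_pos_of_neg (hrpos _ hPD) hneg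
    have h3 := mul_neg_of_neg_of_pos h2 (Real.exp_pos (-(l * t)))
    rw [hS]
    linarith
  have hexp : ∀ x : ℝ, Real.exp (-x) * Real.exp x = 1 := fun x => by
    rw [← Real.exp_add]; simp
  have hvlow : ∀ q ∈ triangle ξ η, -(S * Real.exp (l * q.2)) ≤ v q := by
    intro q hq
    have h1 : v (r₀, t₀) * Real.exp (-(l * t₀)) ≤ v q * Real.exp (-(l * q.2)) := hmin hq
    have h2 := mul_le_mul_of_nonneg_right h1 (Real.exp_pos (l * q.2)).le
    rw [mul_assoc (v q), hexp, mul_one] at h2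
    rw [hS]
    linarith
  have hv₀ : v (r₀, t₀) = -(S * Real.exp (l * t₀)) := by
    rw [hS, neg_mul, neg_neg, mul_assoc, hexp, mul_one]
  obtain ⟨⟨hP1, hP2⟩, hP3⟩ := id hP₀
  simp only at hP1 hP2 hP3
  have ht₀ : 0 < t₀ := by
    rcases hP3.lt_or_eq with h | h
    · exact h
    · exfalso
      have h1 : v (r₀, t₀) = 0 := by
        rw [hv, ← h]
        simp only
        rw [hu.initialPosition r₀ (by linarith), mul_zero]
      rw [hS, h1] at hS0
      simp at hS0
  set ξ₀ := r₀ - t₀ with hξ₀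
  set η₀ := r₀ + t₀ with hη₀
  have hmid : (ξ₀ + η₀) / 2 = r₀ := by rw [hξ₀, hη₀]; ring
  have hhalf : (η₀ - ξ₀) / 2 = t₀ := by rw [hξ₀, hη₀]; ring
  have hΔD : triangle ξ₀ η₀ ⊆ triangle ξ η := triangle_subset_triangle hP1 hP2
  have ht₀t : t₀ ≤ t := by linarith
  -- Near the minimum point `v` is at most half its (negative) value there.
  obtain ⟨ρ, hρ, hball⟩ : ∃ ρ > 0, Metric.ball (r₀, t₀) ρ ∩ triangle ξ η ⊆
      {q | v q < -(S / 2 * Real.exp (l * t₀))} := by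
    refine Metric.mem_nhdsWithin_iff.1 ((hvD (r₀, t₀) hP₀).eventually_lt_const ?_)
    rw [hv₀]
    have := mul_pos hS0 (Real.exp_pos (l * t₀))
    linarith
  have hδρ : min (ρ / 2) t₀ < ρ := (min_le_left _ _).trans_lt (by linarith)
  obtain ⟨χ, κ, hχs, hκc, hzero, hpos, hκsupp, hκint⟩ := exists_triangle_test hn hξ0 hP1
    (by rw [hhalf]; exact (mul_le_mul_of_nonneg_left ht₀t (by positivity)).trans hcone)
    (lt_min (half_pos hρ) ht₀) (by rw [hhalf]; exact min_le_right _ _)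
  rw [hmid, hhalf] at hκsupp
  obtain ⟨hi, hint⟩ := hu.setIntegral_sub_nonpos hR hg hψ (by linarith) (by linarith) hχs hzero
    fun q hq => (hpos q hq).1
  have hi3 : IntegrableOn (fun q : ℝ × ℝ => S / 2 * Real.exp (l * t₀) * κ q)
      (triangle ξ₀ η₀) :=
    ContinuousOn.integrableOn_compact (isCompact_triangle _ _) (by fun_prop)
  have hi4 : IntegrableOn (fun q : ℝ × ℝ => M * S * Real.exp (l * q.2)) (triangle ξ₀ η₀) :=
    ContinuousOn.integrableOn_compact (isCompact_triangle _ _) (by fun_prop)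
  have hpoint : ∀ q ∈ triangle ξ₀ η₀,
      S / 2 * Real.exp (l * t₀) * κ q - M * S * Real.exp (l * q.2) ≤
      q.1 ^ halfDim n * g q.1 (u q) * χ q - q.1 ^ halfDim n * u q * reducedOp n χ q := by
    intro q hq
    have hqD := hΔD hq
    obtain ⟨hχ0, hχ1, hκ0, hrem0, hrem1⟩ := hpos q hq
    have hE : 0 < S * Real.exp (l * q.2) := mul_pos hS0 (Real.exp_pos _)
    have hvq : q.1 ^ halfDim n * u q = v q := rfl
    have hA : -(Λ * (S * Real.exp (l * q.2))) ≤ q.1 ^ halfDim n * g q.1 (u q) * χ q := by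
      have h1 := hgΛ q.1 (hDpos q hqD) (u q) (abs_le.1 (hN q hqD))
      have h2 : q.1 ^ halfDim n * max (-u q) 0 ≤ S * Real.exp (l * q.2) := by
        rcases le_total (-u q) 0 with h | h
        · rw [max_eq_right h, mul_zero]; exact hE.le
        · rw [max_eq_left h]
          linarith [hvlow q hqD]
      have h3 := mul_le_mul_of_nonneg_left h1 (hrpos q hqD).le
      have h4 := mul_le_mul_of_nonneg_left h2 hΛ
      have h5 : -(Λ * (S * Real.exp (l * q.2))) ≤ q.1 ^ halfDim n * g q.1 (u q) := by linarith
      have h6 := mul_le_mul_of_nonneg_right h5 hχ0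
      have h7 := mul_le_mul_of_nonneg_left hχ1 (mul_nonneg hΛ hE.le)
      linarith
    have hB : -(8 * β * (S * Real.exp (l * q.2))) ≤ v q * (κ q - reducedOp n χ q) := by
      have h7 := mul_le_mul_of_nonneg_right (hvlow q hqD) hrem0
      have h8 := mul_le_mul_of_nonneg_left hrem1 hE.le
      linarith
    have hC : S / 2 * Real.exp (l * t₀) * κ q ≤ -(v q * κ q) := by
      by_cases h : κ q = 0
      · rw [h]; simp
      · obtain ⟨h1, h2⟩ := hκsupp q h
        have hmem : q ∈ Metric.ball (r₀, t₀) ρ := by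
          rw [Metric.mem_ball, Prod.dist_eq, max_lt_iff, Real.dist_eq, Real.dist_eq]
          exact ⟨h1.trans_lt hδρ, h2.trans_lt hδρ⟩
        have h5 : v q < -(S / 2 * Real.exp (l * t₀)) := hball ⟨hmem, hqD⟩
        have h6 := mul_le_mul_of_nonneg_right h5.le hκ0
        linarith
    rw [hvq, hM]
    linarith
  have hlower := setIntegral_mono_on (hi3.sub hi4) hi (isCompact_triangle _ _).measurableSet hpoint
  rw [integral_sub' hi3 hi4, integral_const_mul, integral_const_mul, hκint] at hlower
  have hexpint := setIntegral_exp_triangle_le hl0 (show ξ₀ ≤ η₀ by linarith)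
  rw [hhalf, show η₀ - ξ₀ = 2 * t₀ by rw [hξ₀, hη₀]; ring] at hexpint
  set E := Real.exp (l * t₀) with hEdef
  have hE0 : 0 < E := Real.exp_pos _
  have h1 : S * E ≤ M * S * (2 * t₀ * (E / l)) := by
    have := mul_le_mul_of_nonneg_left hexpint (mul_nonneg hM0 hS0.le)
    linarith
  have h2 : M * S * (2 * t₀ * (E / l)) = S * E * (2 * M * t₀ / l) := by ring
  have h3 : 2 * M * t₀ / l < 1 := by
    rw [div_lt_one hl0, hl]
    have := mul_le_mul_of_nonneg_left ht₀t hM0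
    linarith
  have h4 := mul_lt_mul_of_pos_left h3 (mul_pos hS0 hE0)
  linarith

/-! ### Test functions on a large scale -/

theorem deriv_deriv_pow {h : ℝ → ℝ} (hh : ContDiff ℝ ∞ h) (j : ℕ) (x : ℝ) :
    deriv (deriv fun y => h y ^ (j + 2)) x = h x ^ j *
      (((j : ℝ) + 2) * ((j : ℝ) + 1) * deriv h x ^ 2 + ((j : ℝ) + 2) * h x * deriv (deriv h) x) := by
  have hd : ∀ y, HasDerivAt h (deriv h y) y := fun y =>
    (hh.differentiable (by simp) y).hasDerivAt
  have hd2 : HasDerivAt (deriv h) (deriv (deriv h) x) x :=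
    ((contDiff_infty_iff_deriv.1 hh).2.differentiable (by simp) x).hasDerivAt
  have h1 : (deriv fun y => h y ^ (j + 2)) =
      fun y => ((j : ℝ) + 2) * (h y ^ (j + 1) * deriv h y) := by
    funext y
    rw [((hd y).fun_pow (j + 2)).deriv]
    push_cast
    ring
  rw [h1]
  refine (((((hd x).fun_pow (j + 1)).mul hd2).const_mul ((j : ℝ) + 2)).deriv).trans ?_
  push_cast
  ring

theorem reducedOp_scaled_prod (n : ℕ) {f g : ℝ → ℝ} (hf : ContDiff ℝ ∞ f) (hg : ContDiff ℝ ∞ g)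
    {τ : ℝ} (hτ : τ ≠ 0) (q : ℝ × ℝ) :
    reducedOp n (fun z => f (z.1 / τ) * g (z.2 / τ)) q = 1 / τ ^ 2 *
      (f (q.1 / τ) * deriv (deriv g) (q.2 / τ) - deriv (deriv f) (q.1 / τ) * g (q.2 / τ) +
        halfDim n * (halfDim n - 1) / (q.1 / τ) ^ 2 * (f (q.1 / τ) * g (q.2 / τ))) := by
  have D : ∀ {h : ℝ → ℝ}, ContDiff ℝ ∞ h → ∀ x,
      HasDerivAt (fun s => h (s / τ)) (deriv h (x / τ) * (1 / τ)) x := fun hh x =>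
    ((hh.differentiable (by simp) (x / τ)).hasDerivAt).comp x ((hasDerivAt_id x).div_const τ)
  have hf' : ContDiff ℝ ∞ (deriv f) := (contDiff_infty_iff_deriv.1 hf).2
  have hg' : ContDiff ℝ ∞ (deriv g) := (contDiff_infty_iff_deriv.1 hg).2
  have h1 : dt (fun z => f (z.1 / τ) * g (z.2 / τ)) =
      fun z => f (z.1 / τ) * (deriv g (z.2 / τ) * (1 / τ)) :=
    funext fun z => ((D hg z.2).const_mul (f (z.1 / τ))).deriv
  have h2 : dr (fun z => f (z.1 / τ) * g (z.2 / τ)) =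
      fun z => deriv f (z.1 / τ) * (1 / τ) * g (z.2 / τ) :=
    funext fun z => ((D hf z.1).mul_const (g (z.2 / τ))).deriv
  have h3 : dt (fun z : ℝ × ℝ => f (z.1 / τ) * (deriv g (z.2 / τ) * (1 / τ))) q =
      f (q.1 / τ) * (deriv (deriv g) (q.2 / τ) * (1 / τ) * (1 / τ)) :=
    (((D hg' q.2).mul_const (1 / τ)).const_mul (f (q.1 / τ))).deriv
  have h4 : dr (fun z : ℝ × ℝ => deriv f (z.1 / τ) * (1 / τ) * g (z.2 / τ)) q =
      deriv (deriv f) (q.1 / τ) * (1 / τ) * (1 / τ) * g (q.2 / τ) :=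
    (((D hf' q.1).mul_const (1 / τ)).mul_const (g (q.2 / τ))).deriv
  have h5 : halfDim n * (halfDim n - 1) / q.1 ^ 2 =
      1 / τ ^ 2 * (halfDim n * (halfDim n - 1) / (q.1 / τ) ^ 2) := by
    by_cases hq : q.1 = 0
    · simp [hq]
    · field_simp
  unfold reducedOp
  rw [h1, h2, h3, h4, h5]
  ring

/-- Test functions on the scale `τ`, taken as a high power of a fixed cutoff so that two
derivatives cost a factor `τ ^ (-2)` and at most the power `1 - 1 / p` of the function. -/
theorem exists_scaled_test (n : ℕ) {p : ℝ} (hp : 1 < p) {a : ℝ} (ha : 0 < a) :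
    ∃ B : ℝ, 0 < B ∧ ∀ τ : ℝ, 0 < τ → ∃ χ : ℝ × ℝ → ℝ, ContDiff ℝ ∞ χ ∧ (∀ q, 0 ≤ χ q) ∧
      (∀ q, χ q ≠ 0 → a * τ ≤ q.1 ∧ q.1 ≤ (a + 3) * τ ∧ q.2 ≤ τ / 2) ∧
      (∀ r ∈ Icc ((a + 1) * τ) ((a + 2) * τ), χ (r, 0) = 1) ∧
      ∀ q, 0 ≤ q.2 → |reducedOp n χ q| ≤ B / τ ^ 2 * χ q ^ (1 / p) := by
  set X : ℝ → ℝ := fun x => Real.smoothTransition (x - a) * Real.smoothTransition (a + 3 - x)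
    with hX
  set Y : ℝ → ℝ := fun y => Real.smoothTransition (1 - 2 * y) with hY
  have hσ : ContDiff ℝ ∞ Real.smoothTransition := Real.smoothTransition.contDiff
  have hXs : ContDiff ℝ ∞ X := by fun_prop
  have hYs : ContDiff ℝ ∞ Y := by fun_prop
  have hX0 : ∀ x, 0 ≤ X x := fun x =>
    mul_nonneg (Real.smoothTransition.nonneg _) (Real.smoothTransition.nonneg _)
  have hY0 : ∀ y, 0 ≤ Y y := fun y => Real.smoothTransition.nonneg _
  have hX1 : ∀ x, X x ≤ 1 := fun x => mul_le_one₀ (Real.smoothTransition.le_one _)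
    (Real.smoothTransition.nonneg _) (Real.smoothTransition.le_one _)
  have hY1 : ∀ y, Y y ≤ 1 := fun y => Real.smoothTransition.le_one _
  have hXsupp : ∀ x, X x ≠ 0 → a ≤ x ∧ x ≤ a + 3 := by
    intro x hx
    constructor
    · by_contra! h
      exact left_ne_zero_of_mul hx (Real.smoothTransition.zero_of_nonpos (by linarith))
    · by_contra! h
      exact right_ne_zero_of_mul hx (Real.smoothTransition.zero_of_nonpos (by linarith))
  have hYsupp : ∀ y, Y y ≠ 0 → y ≤ 1 / 2 := by
    intro y hy
    by_contra! h
    exact hy (Real.smoothTransition.zero_of_nonpos (by linarith))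
  -- The exponent `j + 2` is chosen so that `(j + 2) / p ≤ j`.
  obtain ⟨j, hj⟩ := exists_nat_gt (2 / (p - 1))
  have hj0 : (0 : ℝ) < j := (div_pos two_pos (by linarith)).trans hj
  have hjne : j ≠ 0 := by
    rintro rfl
    simp at hj0
  have hjp : ((j : ℝ) + 2) / p ≤ j := by
    rw [div_lt_iff₀ (by linarith)] at hj
    rw [div_le_iff₀ (by linarith)]
    linarith
  set dX : ℝ → ℝ := fun x => ((j : ℝ) + 2) * ((j : ℝ) + 1) * deriv X x ^ 2 +
    ((j : ℝ) + 2) * X x * deriv (deriv X) x with hdX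
  set dY : ℝ → ℝ := fun x => ((j : ℝ) + 2) * ((j : ℝ) + 1) * deriv Y x ^ 2 +
    ((j : ℝ) + 2) * Y x * deriv (deriv Y) x with hdY
  have hcont : ∀ {h : ℝ → ℝ}, ContDiff ℝ ∞ h → Continuous (fun x =>
      ((j : ℝ) + 2) * ((j : ℝ) + 1) * deriv h x ^ 2 + ((j : ℝ) + 2) * h x * deriv (deriv h) x) := by
    intro h hh
    have h1 := (contDiff_infty_iff_deriv.1 hh).2
    have c0 := hh.continuous
    have c1 := h1.continuous
    have c2 := (contDiff_infty_iff_deriv.1 h1).2.continuous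
    fun_prop
  have hdXc : Continuous dX := hcont hXs
  have hdYc : Continuous dY := hcont hYs
  set e : ℝ × ℝ → ℝ := fun z => X z.1 ^ 2 * dY z.2 - dX z.1 * Y z.2 ^ 2 +
    halfDim n * (halfDim n - 1) / z.1 ^ 2 * (X z.1 ^ 2 * Y z.2 ^ 2) with he
  have hec : ContinuousOn e (Icc a (a + 3) ×ˢ Icc 0 (1 / 2)) := by
    have c1 := hXs.continuous
    have c2 := hYs.continuous
    refine ContinuousOn.add (by fun_prop) (ContinuousOn.mul ?_ (by fun_prop))
    exact continuousOn_const.div (by fun_prop) fun z hz =>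
      pow_ne_zero 2 (ha.trans_le hz.1.1).ne'
  obtain ⟨B, hB⟩ := (isCompact_Icc.prod isCompact_Icc).exists_bound_of_continuousOn hec
  refine ⟨max B 1, lt_max_of_lt_right one_pos, fun τ hτ => ?_⟩
  refine ⟨fun z => X (z.1 / τ) ^ (j + 2) * Y (z.2 / τ) ^ (j + 2), by fun_prop,
    fun q => mul_nonneg (pow_nonneg (hX0 _) _) (pow_nonneg (hY0 _) _), ?_, ?_, ?_⟩
  · intro q hq
    obtain ⟨h1, h2⟩ := hXsupp _ (ne_zero_pow (by omega) (left_ne_zero_of_mul hq))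
    have h3 := hYsupp _ (ne_zero_pow (by omega) (right_ne_zero_of_mul hq))
    rw [le_div_iff₀ hτ] at h1
    rw [div_le_iff₀ hτ] at h2 h3
    exact ⟨h1, h2, by linarith⟩
  · rintro r ⟨h1, h2⟩
    rw [← le_div_iff₀ hτ] at h1
    rw [← div_le_iff₀ hτ] at h2
    have hX' : X (r / τ) = 1 := by
      rw [hX]
      simp only
      rw [Real.smoothTransition.one_of_one_le (by linarith),
        Real.smoothTransition.one_of_one_le (by linarith), one_mul]
    have hY' : Y (0 / τ) = 1 := by
      rw [hY]
      simp only
      rw [Real.smoothTransition.one_of_one_le (by simp)]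
    simp only [hX', hY', one_pow, one_mul]
  · intro q hq
    set x := q.1 / τ with hx
    set y := q.2 / τ with hy
    have hy0 : 0 ≤ y := div_nonneg hq hτ.le
    set w := X x * Y y with hw
    have hw0 : 0 ≤ w := mul_nonneg (hX0 _) (hY0 _)
    have hw1 : w ≤ 1 := mul_le_one₀ (hX1 _) (hY0 _) (hY1 _)
    have hred := reducedOp_scaled_prod n (hXs.pow (j + 2)) (hYs.pow (j + 2)) hτ.ne' q
    rw [deriv_deriv_pow hXs, deriv_deriv_pow hYs, ← hx, ← hy] at hred
    have hred' : reducedOp n (fun z => X (z.1 / τ) ^ (j + 2) * Y (z.2 / τ) ^ (j + 2)) q =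
        1 / τ ^ 2 * (w ^ j * e (x, y)) := by
      rw [hred, he, hw, hdX, hdY]
      simp only
      ring
    have hχq : X x ^ (j + 2) * Y y ^ (j + 2) = w ^ (j + 2) := (mul_pow _ _ _).symm
    simp only [← hx, ← hy]
    rw [hred', hχq, abs_mul, abs_mul, abs_of_pos (by positivity : 0 < 1 / τ ^ 2),
      abs_of_nonneg (pow_nonneg hw0 j)]
    have hpow : w ^ j ≤ (w ^ (j + 2)) ^ (1 / p) := by
      rw [← Real.rpow_natCast w (j + 2), ← Real.rpow_mul hw0, ← Real.rpow_natCast w j]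
      push_cast
      rw [mul_one_div]
      exact Real.rpow_le_rpow_of_exponent_ge' hw0 hw1 (by positivity) hjp
    have hwe : w ^ j * |e (x, y)| ≤ w ^ j * max B 1 := by
      by_cases h0 : w = 0
      · rw [h0, zero_pow hjne, zero_mul, zero_mul]
      · have h1 := hXsupp _ (left_ne_zero_of_mul h0)
        have h2 := hYsupp _ (right_ne_zero_of_mul h0)
        have h3 := hB (x, y) ⟨h1, hy0, h2⟩
        exact mul_le_mul_of_nonneg_left (h3.trans (le_max_left _ _)) (pow_nonneg hw0 j)
    have hB0 : 0 ≤ max B 1 := zero_le_one.trans (le_max_right _ _)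
    calc 1 / τ ^ 2 * (w ^ j * |e (x, y)|) ≤ 1 / τ ^ 2 * (w ^ j * max B 1) := by gcongr
      _ ≤ 1 / τ ^ 2 * ((w ^ (j + 2)) ^ (1 / p) * max B 1) := by gcongr
      _ = max B 1 / τ ^ 2 * (w ^ (j + 2)) ^ (1 / p) := by ring

/-! ### Estimate of the data and of the lifespan -/

/-- Young's inequality with a prescribed coefficient of `y ^ p` and a non-optimal constant. -/
theorem mul_le_mul_rpow_add {A p : ℝ} (hA : 0 < A) (hp : 1 < p) {y z : ℝ} (hy : 0 ≤ y)
    (hz : 0 ≤ z) : y * z ≤ A * y ^ p + (z / A) ^ (1 / (p - 1)) * z := by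
  have hp1 : 0 < p - 1 := by linarith
  have hzA : 0 ≤ z / A := div_nonneg hz hA.le
  rcases le_total y ((z / A) ^ (1 / (p - 1))) with h | h
  · have h1 := mul_le_mul_of_nonneg_right h hz
    have h2 := mul_nonneg hA.le (Real.rpow_nonneg hy p)
    linarith
  · have h1 : z / A ≤ y ^ (p - 1) := by
      have := Real.rpow_le_rpow (Real.rpow_nonneg hzA _) h hp1.le
      rwa [← Real.rpow_mul hzA, one_div_mul_cancel hp1.ne', Real.rpow_one] at this
    have h2 : z ≤ A * y ^ (p - 1) := by
      rw [div_le_iff₀ hA] at h1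
      linarith
    have h3 : y ^ p = y * y ^ (p - 1) := by
      nth_rewrite 2 [← Real.rpow_one y]
      rw [← Real.rpow_add' hy (by linarith)]
      congr 1
      ring
    have h4 := mul_le_mul_of_nonneg_left h2 hy
    have h5 := mul_nonneg (Real.rpow_nonneg hzA (1 / (p - 1))) hz
    rw [h3]
    linarith

/-- The nonlinearity is nonnegative for `x ≥ 0`, where `V ≤ 0` and `F ≥ 0`; for `x < 0` the bound
comes from local Lipschitz continuity. -/
theorem nonlinearity_lower_bound {R A p : ℝ} (hA : 0 < A) {F V : ℝ → ℝ} (hF : ContDiff ℝ 1 F)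
    (hF0 : F 0 = 0) (hFA : ∀ u, 0 ≤ u → A * u ^ p ≤ F u) (hV : ContinuousOn V (Ioi R))
    (hV0 : ∀ r, R < r → V r ≤ 0) (ξ η N : ℝ) (hξ : R < ξ) : ∃ Λ : ℝ, 0 ≤ Λ ∧
      ∀ r ∈ Icc ξ η, ∀ x ∈ Icc (-N) N, -(Λ * max (-x) 0) ≤ F x - V r * x := by
  obtain ⟨L, hL⟩ := isCompact_Icc.exists_bound_of_continuousOn
    (hF.continuous_deriv le_rfl).continuousOn (s := Icc (-N) N)
  obtain ⟨L', hL'⟩ := isCompact_Icc.exists_bound_of_continuousOn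
    (hV.mono fun r (hr : r ∈ Icc ξ η) => hξ.trans_le hr.1)
  refine ⟨|L| + |L'|, by positivity, fun r hr x hx => ?_⟩
  rcases le_or_gt 0 x with h | h
  · have h1 := hFA x h
    have h2 := mul_nonneg hA.le (Real.rpow_nonneg h p)
    have h3 := mul_nonneg (neg_nonneg.2 (hV0 r (hξ.trans_le hr.1))) h
    rw [max_eq_right (by linarith)]
    linarith
  · rw [max_eq_left (by linarith)]
    have hN : (0 : ℝ) ∈ Icc (-N) N := ⟨by linarith [hx.1], by linarith [hx.1]⟩
    have h1 := (convex_Icc (-N) N).norm_image_sub_le_of_norm_deriv_le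
      (fun y _ => hF.differentiable (by simp) y) hL hN hx
    rw [hF0, sub_zero, sub_zero, Real.norm_eq_abs, Real.norm_eq_abs, abs_of_neg h] at h1
    have h2 := hL' r hr
    rw [Real.norm_eq_abs] at h2
    have h3 := mul_le_mul_of_nonneg_right (le_abs_self L) (neg_nonneg.2 h.le)
    have h4 := mul_le_mul_of_nonneg_right (((neg_abs_le (V r)).trans' (neg_le_neg h2)).trans'
      (neg_le_neg (le_abs_self L'))) (neg_nonneg.2 h.le)
    have h5 := (abs_le.1 h1).1
    linarith

/-- The test function estimate: testing the equation on the scale `T` bounds the weighted mass of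
the initial velocity by a negative power of `T`. -/
theorem IsSolution.data_le {n : ℕ} (hn : 1 ≤ n) {R : ℝ} (hR : 0 < R) {A : ℝ} (hA : 0 < A)
    {p : ℝ} (hp : 1 < p) {B : ℝ} (hB : 0 < B) {g : ℝ → ℝ → ℝ}
    (hg : ContinuousOn (fun z : ℝ × ℝ => g z.1 z.2) (Ioi R ×ˢ univ))
    (hlow : ∀ ξ η N : ℝ, R < ξ → ∃ Λ : ℝ, 0 ≤ Λ ∧
      ∀ r ∈ Icc ξ η, ∀ x ∈ Icc (-N) N, -(Λ * max (-x) 0) ≤ g r x)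
    (hgA : ∀ r, R < r → ∀ x, 0 ≤ x → A * x ^ p ≤ g r x)
    {k ε : ℝ} (hk : 0 ≤ k) (hε : 0 < ε) {ψ : ℝ → ℝ} (hψc : ContinuousOn ψ (Ioi R))
    (hψ : ∀ r, R < r → ε * r ^ (-k - 1) ≤ ψ r) {T : ℝ} (hRT : R ≤ T) {u : ℝ × ℝ → ℝ}
    (hu : IsSolution n R T g ψ u) {a : ℝ} (ha : a = n + 3) {χ : ℝ × ℝ → ℝ}
    (hχs : ContDiff ℝ ∞ χ) (hχ0 : ∀ q, 0 ≤ χ q)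
    (hχsupp : ∀ q, χ q ≠ 0 → a * T ≤ q.1 ∧ q.1 ≤ (a + 3) * T ∧ q.2 ≤ T / 2)
    (hχ1 : ∀ r ∈ Icc ((a + 1) * T) ((a + 2) * T), χ (r, 0) = 1)
    (hred : ∀ q, 0 ≤ q.2 → |reducedOp n χ q| ≤ B / T ^ 2 * χ q ^ (1 / p)) :
    ε * ((a + 1) * T) ^ halfDim n * ((a + 2) * T) ^ (-k - 1) * T ≤
      ((a + 3) * T) ^ halfDim n * ((B / T ^ 2 / A) ^ (1 / (p - 1)) * (B / T ^ 2)) *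
        (3 / 2 * T ^ 2) := by
  have hT : 0 < T := hR.trans_le hRT
  have hn1 : (1 : ℝ) ≤ n := by exact_mod_cast hn
  have ha4 : 4 ≤ a := by linarith
  have haT : 4 * T ≤ a * T := mul_le_mul_of_nonneg_right ha4 hT.le
  have hm : 0 ≤ halfDim n := by unfold halfDim; linarith
  have hψ0 : ∀ r, R < r → 0 ≤ ψ r := fun r hr =>
    (mul_nonneg hε.le (Real.rpow_nonneg (hR.trans hr).le _)).trans (hψ r hr)
  set K := (B / T ^ 2 / A) ^ (1 / (p - 1)) * (B / T ^ 2) with hK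
  have hK0 : 0 ≤ K := by positivity
  set Q : Set (ℝ × ℝ) := Icc (a * T) ((a + 3) * T) ×ˢ Icc 0 (T / 2) with hQ
  have hQc : IsCompact Q := isCompact_Icc.prod isCompact_Icc
  have hQreg : Q ⊆ region R T := by
    rintro q ⟨⟨h1, h2⟩, h3, h4⟩
    exact ⟨by linarith, h3, by linarith⟩
  have hQR : ∀ q ∈ Q, R < q.1 := fun q hq => by linarith [hq.1.1]
  have hupos : ∀ q ∈ Q, 0 ≤ u q := by
    rintro ⟨r, t⟩ ⟨⟨h1, h2⟩, h3, h4⟩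
    simp only at h1 h2 h3 h4
    refine hu.nonneg hn hR hg hlow hψ0 (by linarith) h3 (by linarith) ?_
    have h5 : (n : ℝ) * t ≤ n * (T / 2) := mul_le_mul_of_nonneg_left h4 (by linarith)
    have h6 : a * T = n * T + 3 * T := by rw [ha]; ring
    have h7 : 0 ≤ (n : ℝ) * T := by positivity
    linarith
  have hid := hu.reduced_identity hR hχs (ξ := a * T - T / 2) (η := (a + 3) * T + T / 2)
    (T' := T / 2) (by linarith) (by linarith) fun q hq => by
      obtain ⟨h1, h2, h3⟩ := hχsupp q hq
      exact ⟨by linarith, by linarith, h3⟩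
  have hout : ∀ q ∈ region R T \ Q, χ q = 0 := by
    rintro q ⟨hq, hq'⟩
    by_contra h
    obtain ⟨h1, h2, h3⟩ := hχsupp q h
    exact hq' ⟨⟨h1, h2⟩, hq.2.1, h3⟩
  have hp0 : 1 / p ≠ 0 := by positivity
  have e1 : ∫ q in region R T, q.1 ^ halfDim n * u q * reducedOp n χ q =
      ∫ q in Q, q.1 ^ halfDim n * u q * reducedOp n χ q := by
    refine setIntegral_eq_of_subset_of_forall_sdiff_eq_zero (measurableSet_region R T) hQreg
      fun q hq => ?_
    have h1 := hred q hq.1.2.1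
    rw [hout q hq, Real.zero_rpow hp0, mul_zero] at h1
    rw [abs_nonpos_iff.1 h1, mul_zero]
  have e2 : ∫ q in region R T, q.1 ^ halfDim n * g q.1 (u q) * χ q =
      ∫ q in Q, q.1 ^ halfDim n * g q.1 (u q) * χ q := by
    refine setIntegral_eq_of_subset_of_forall_sdiff_eq_zero (measurableSet_region R T) hQreg
      fun q hq => ?_
    rw [hout q hq, mul_zero]
  rw [e1, e2] at hid
  have huc : ContinuousOn u Q := hu.continuousOn.mono hQreg
  have hrc : ContinuousOn (fun q : ℝ × ℝ => q.1 ^ halfDim n) Q :=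
    continuousOn_fst.rpow_const fun q hq => Or.inl (hR.trans (hQR q hq)).ne'
  have hi1 : IntegrableOn (fun q => q.1 ^ halfDim n * u q * reducedOp n χ q) Q := by
    refine ContinuousOn.integrableOn_compact hQc ((hrc.mul huc).mul ?_)
    refine ((contDiff_dt (contDiff_dt hχs)).continuous.sub
      (contDiff_dr (contDiff_dr hχs)).continuous).continuousOn.add (ContinuousOn.mul ?_
      hχs.continuous.continuousOn)
    exact continuousOn_const.div (by fun_prop) fun q hq =>
      pow_ne_zero 2 (hR.trans (hQR q hq)).ne'
  have hi2 : IntegrableOn (fun q => q.1 ^ halfDim n * g q.1 (u q) * χ q) Q := by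
    refine ContinuousOn.integrableOn_compact hQc ((hrc.mul ?_).mul hχs.continuous.continuousOn)
    exact hg.comp (continuousOn_fst.prodMk huc) fun q hq => ⟨hQR q hq, mem_univ _⟩
  -- Young's inequality absorbs the linear term into the nonlinearity.
  have hpoint : ∀ q ∈ Q, q.1 ^ halfDim n * u q * reducedOp n χ q -
      q.1 ^ halfDim n * g q.1 (u q) * χ q ≤ ((a + 3) * T) ^ halfDim n * K := by
    intro q hq
    have hq0 : 0 ≤ q.1 := (hR.trans (hQR q hq)).le
    have hu0 := hupos q hq
    have h1 : u q * reducedOp n χ q ≤ u q * χ q ^ (1 / p) * (B / T ^ 2) := by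
      have := mul_le_mul_of_nonneg_left ((le_abs_self _).trans (hred q hq.2.1)) hu0
      linarith
    have h2 := mul_le_mul_rpow_add hA hp (mul_nonneg hu0 (Real.rpow_nonneg (hχ0 q) (1 / p)))
      (by positivity : 0 ≤ B / T ^ 2)
    rw [Real.mul_rpow hu0 (Real.rpow_nonneg (hχ0 q) _), ← Real.rpow_mul (hχ0 q),
      one_div_mul_cancel (by linarith : p ≠ 0), Real.rpow_one, ← hK] at h2
    have h3 := mul_le_mul_of_nonneg_right (hgA q.1 (hQR q hq) (u q) hu0) (hχ0 q)
    have h4 : u q * reducedOp n χ q - g q.1 (u q) * χ q ≤ K := by linarith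
    have h5 := mul_le_mul_of_nonneg_left h4 (Real.rpow_nonneg hq0 (halfDim n))
    have h6 := mul_le_mul_of_nonneg_right (Real.rpow_le_rpow hq0 hq.1.2 hm) hK0
    linarith
  have hupper : ∫ r in Ioi R, r ^ halfDim n * ψ r * χ (r, 0) ≤
      ((a + 3) * T) ^ halfDim n * K * (3 / 2 * T ^ 2) := by
    have h1 := setIntegral_mono_on (hi1.sub hi2) (integrableOn_const hQc.measure_lt_top.ne)
      hQc.measurableSet hpoint
    have hvol : volume.real Q = 3 / 2 * T ^ 2 := by
      rw [hQ, Measure.volume_eq_prod, measureReal_prod_prod, Real.volume_real_Icc_of_le (by linarith),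
        Real.volume_real_Icc_of_le (by linarith)]
      ring
    rw [integral_sub' hi1 hi2, setIntegral_const, hvol, smul_eq_mul] at h1
    linarith
  have hlower : ε * ((a + 1) * T) ^ halfDim n * ((a + 2) * T) ^ (-k - 1) * T ≤
      ∫ r in Ioi R, r ^ halfDim n * ψ r * χ (r, 0) := by
    have hI : Icc (a * T) ((a + 3) * T) ⊆ Ioi R := fun r hr => by
      have := hr.1
      exact mem_Ioi.2 (by linarith)
    have hJ : Icc ((a + 1) * T) ((a + 2) * T) ⊆ Icc (a * T) ((a + 3) * T) :=
      Icc_subset_Icc (by linarith) (by linarith)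
    have h1 : ∫ r in Ioi R, r ^ halfDim n * ψ r * χ (r, 0) =
        ∫ r in Icc (a * T) ((a + 3) * T), r ^ halfDim n * ψ r * χ (r, 0) := by
      refine setIntegral_eq_of_subset_of_forall_sdiff_eq_zero measurableSet_Ioi hI fun r hr => ?_
      have : χ (r, 0) = 0 := by
        by_contra h
        obtain ⟨h1, h2, _⟩ := hχsupp _ h
        exact hr.2 ⟨h1, h2⟩
      rw [this, mul_zero]
    have hi : IntegrableOn (fun r => r ^ halfDim n * ψ r * χ (r, 0))
        (Icc (a * T) ((a + 3) * T)) := by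
      refine ContinuousOn.integrableOn_compact isCompact_Icc (((continuousOn_id.rpow_const
        fun r hr => Or.inl (hR.trans (hI hr)).ne').mul (hψc.mono hI)).mul ?_)
      exact (hχs.continuous.comp (by fun_prop : Continuous fun r : ℝ => (r, (0 : ℝ)))).continuousOn
    have hnn : ∀ r ∈ Icc (a * T) ((a + 3) * T), 0 ≤ r ^ halfDim n * ψ r * χ (r, 0) :=
      fun r hr => mul_nonneg (mul_nonneg (Real.rpow_nonneg (hR.trans (hI hr)).le _)
        (hψ0 r (hI hr))) (hχ0 _)
    have h2 : ∫ r in Icc ((a + 1) * T) ((a + 2) * T), r ^ halfDim n * ψ r * χ (r, 0) ≤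
        ∫ r in Icc (a * T) ((a + 3) * T), r ^ halfDim n * ψ r * χ (r, 0) :=
      setIntegral_mono_set hi ((ae_restrict_iff' measurableSet_Icc).2 (Eventually.of_forall hnn))
        hJ.eventuallyLE
    have h3 := setIntegral_mono_on (μ := volume) (s := Icc ((a + 1) * T) ((a + 2) * T))
      (f := fun _ => ((a + 1) * T) ^ halfDim n * (ε * ((a + 2) * T) ^ (-k - 1)))
      (integrableOn_const isCompact_Icc.measure_lt_top.ne) (hi.mono_set hJ) measurableSet_Icc
      fun r hr => by
        have hrR : R < r := hI (hJ hr)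
        have hr0 : 0 < r := hR.trans hrR
        rw [hχ1 r hr, mul_one]
        have h4 : ((a + 1) * T) ^ halfDim n ≤ r ^ halfDim n :=
          Real.rpow_le_rpow (by positivity) hr.1 hm
        have h5 : ((a + 2) * T) ^ (-k - 1) ≤ r ^ (-k - 1) :=
          Real.rpow_le_rpow_of_nonpos hr0 hr.2 (by linarith)
        exact mul_le_mul h4 ((mul_le_mul_of_nonneg_left h5 hε.le).trans (hψ r hrR))
          (by positivity) (by positivity)
    rw [setIntegral_const, Real.volume_real_Icc_of_le (by linarith), smul_eq_mul] at h3
    rw [h1]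
    refine le_trans (le_of_eq ?_) (h3.trans h2)
    ring
  exact hlower.trans hupper

end ExteriorWave

theorem theorem5p1 (n : ℕ) (hn : 1 ≤ n) (R : ℝ) (hR : 0 < R) (A : ℝ) (hA : 0 < A)
    (p : ℝ) (hp : 1 < p) (k : ℝ) (hk0 : 0 ≤ k) (hk : k < 2 / (p - 1))
    (ε₀ : ℝ) (hε₀ : 0 < ε₀) :
    ∃ C : ℝ, 0 < C ∧
      ∀ F : ℝ → ℝ, ContDiff ℝ 1 F → F 0 = 0 → (∀ u : ℝ, 0 ≤ u → 0 ≤ deriv F u) →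
        (∀ u : ℝ, 0 ≤ u → A * u ^ p ≤ F u) →
      ∀ V : ℝ → ℝ, ContDiffOn ℝ 1 V (Set.Ioi R) → (∀ r : ℝ, R < r → V r ≤ 0) →
      ∀ ε : ℝ, 0 < ε → ε ≤ ε₀ →
      ∀ ψ : ℝ → ℝ, ContinuousOn ψ (Set.Ioi R) → (∀ r : ℝ, R < r → ε * r ^ (-k - 1) ≤ ψ r) →
        ExteriorWave.lifespan n R (fun r u => F u - V r * u) ψ ≤
          ENNReal.ofReal (C * ε ^ (-(p - 1) / (2 - k * (p - 1)))) := by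
  set a : ℝ := (n : ℝ) + 3 with ha
  have ha0 : 0 < a := by positivity
  set m := ExteriorWave.halfDim n with hm
  obtain ⟨B, hB, htest⟩ := ExteriorWave.exists_scaled_test n hp ha0
  have hp1 : 0 < p - 1 := by linarith
  set γ := 2 / (p - 1) - k with hγ
  have hγ0 : 0 < γ := by rw [hγ]; linarith
  have hexp : -(p - 1) / (2 - k * (p - 1)) = -(1 / γ) := by
    have h1 : γ = (2 - k * (p - 1)) / (p - 1) := by rw [hγ]; field_simp
    rw [h1, one_div_div, neg_div]
  set D := (a + 3) ^ m * ((B / A) ^ (1 / (p - 1)) * B) * (3 / 2) /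
    ((a + 1) ^ m * (a + 2) ^ (-k - 1)) with hD
  have hD0 : 0 < D := by positivity
  refine ⟨D ^ (1 / γ) + R * ε₀ ^ (1 / γ), by positivity, ?_⟩
  intro F hF hF0 _ hFA V hV hV0 ε hε hεε₀ ψ hψc hψ
  rw [hexp]
  refine iSup_le fun T => iSup_le fun hT => iSup_le fun hex => ENNReal.ofReal_le_ofReal ?_
  obtain ⟨u, hu⟩ := hex
  have hε' : ε ^ (-(1 / γ)) = (ε ^ (1 / γ))⁻¹ := Real.rpow_neg hε.le _
  rw [add_mul]
  rcases lt_or_ge T R with hTR | hRT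
  · -- Up to the time `R` the bound holds because `ε ≤ ε₀`.
    have h1 : 1 ≤ ε₀ ^ (1 / γ) * ε ^ (-(1 / γ)) := by
      rw [hε', ← div_eq_mul_inv, one_le_div (by positivity)]
      exact Real.rpow_le_rpow hε.le hεε₀ (by positivity)
    have h2 := mul_le_mul_of_nonneg_left h1 hR.le
    have h3 : 0 ≤ D ^ (1 / γ) * ε ^ (-(1 / γ)) := by positivity
    linarith
  · obtain ⟨χ, hχs, hχ0, hχsupp, hχ1, hred⟩ := htest T hT
    have hmain := ExteriorWave.IsSolution.data_le hn hR hA hp hB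
      (by
        have h1 : Continuous F := hF.continuous
        refine ContinuousOn.sub (by fun_prop) (ContinuousOn.mul ?_ (by fun_prop))
        exact hV.continuousOn.comp continuousOn_fst fun z hz => hz.1)
      (ExteriorWave.nonlinearity_lower_bound hA hF hF0 hFA hV.continuousOn hV0)
      (fun r hr x hx => by
        have h1 := mul_nonneg (neg_nonneg.2 (hV0 r hr)) hx
        have h2 := hFA x hx
        linarith)
      hk0 hε hψc hψ hRT hu ha hχs hχ0 hχsupp hχ1 hred
    have hDε : T ^ γ ≤ D / ε := by
      rw [← hm] at hmain
      have e1 : (B / T ^ 2 / A) ^ (1 / (p - 1)) =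
          (B / A) ^ (1 / (p - 1)) * (T ^ (2 / (p - 1)))⁻¹ := by
        rw [show B / T ^ 2 / A = B / A * (T ^ 2)⁻¹ by field_simp,
          Real.mul_rpow (by positivity) (by positivity), Real.inv_rpow (by positivity),
          ← Real.rpow_natCast, ← Real.rpow_mul hT.le]
        congr 3
        push_cast
        ring
      have e2 : T ^ (-k - 1) = (T ^ k)⁻¹ * T⁻¹ := by
        rw [Real.rpow_sub_one hT.ne', Real.rpow_neg hT.le, div_eq_mul_inv]
      have e3 : T ^ γ = T ^ (2 / (p - 1)) / T ^ k := Real.rpow_sub hT _ _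
      rw [Real.mul_rpow (by positivity) hT.le, Real.mul_rpow (by positivity) hT.le,
        Real.mul_rpow (by positivity) hT.le, e1, e2] at hmain
      have hTk : 0 < T ^ k := by positivity
      rw [e3, hD, div_div, div_le_div_iff₀ hTk (by positivity)]
      have h1 := mul_le_mul_of_nonneg_right hmain
        (by positivity : 0 ≤ (T ^ m)⁻¹ * T ^ k * T ^ (2 / (p - 1)))
      refine (le_of_eq ?_).trans (h1.trans (le_of_eq ?_)) <;> field_simp
    have h1 := Real.rpow_le_rpow (by positivity) hDε (by positivity : 0 ≤ 1 / γ)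
    rw [← Real.rpow_mul hT.le, mul_one_div_cancel hγ0.ne', Real.rpow_one,
      Real.div_rpow hD0.le hε.le, div_eq_mul_inv, ← hε'] at h1
    have h2 : 0 ≤ R * ε₀ ^ (1 / γ) * ε ^ (-(1 / γ)) := by positivity
    linarith
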